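/- **Theorem (Uniqueness of the dual charge).** Let $d\ge 3$ and $N\ge 2$ be integers, and let $\rho\in L^1(\mathbb R^d,\mathbb R_+)$ with $\int_{\mathbb R^d}\rho=N$. Let $\Omega$ be the support of $\rho$ (i.e. of the measure $\rho(x)\,dx$), and suppose that $\Omega$ is connected. For a continuous $v:\mathbb R^d\to\mathbb R$ put $$E_N(v)=\inf_{r_1,\dots,r_N\in\mathbb R^d}\Big\{\sum_{1\le i<j\le N}\frac1{|r_i-r_j|^{d-2}}-\sum_{i=1}^N v(r_i)\Big\},$$ where $1/0=+\infty$. A *Kantorovich potential* is a maximizer of $v\mapsto E_N(v)+\int_{\mathbb R^d}v\rho$ among all continuous $v:\mathbb R^d\to\mathbb R$ with $\int|v|\rho<\infty$. A *dual charge* is a locally finite signed Borel measure $\mu$ on $\mathbb R^d$ (a difference $\mu=\mu^+-\mu^-$ of two mutually singular locally finite positive measures) whose Coulomb potential $v=\mu*|\cdot|^{2-d}$ is a Kantorovich potential; here $v=\mu*|\cdot|^{2-d}$ means that for almost every $x$ the integral $\int|x-y|^{2-d}\,\mu(dy)$ converges absolutely and equals $v(x)$. If $\rho_{\rm ext}$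 and $\mu_{\rm ext}$ are two dual charges whose Coulomb potentials $\rho_{\rm ext}*|\cdot|^{2-d}$ and $\mu_{\rm ext}*|\cdot|^{2-d}$ are Lipschitz, then $\rho_{\rm ext}=\mu_{\rm ext}$ on the topological interior of $\Omega$, i.e. their restrictions to the interior of $\Omega$ are the same signed measure. -/

import Mathlib

open MeasureTheory

noncomputable section

namespace Coulomb

/-- The Euclidean space `ℝ^d`. -/
abbrev Space (d : ℕ) : Type := EuclideanSpace ℝ (Fin d)

/-- The Coulomb kernel `|x - y|^{2 - d}` (for `d ≥ 3`), with value `+∞` on the diagonal. -/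
def kernel {d : ℕ} (x y : Space d) : ENNReal := (edist x y ^ (d - 2))⁻¹

/-- The Coulomb cost `c(r₁, …, r_N) = ∑_{i < j} |r_i - r_j|^{2 - d}`, in `[0, +∞]`. -/
def cost {d N : ℕ} (r : Fin N → Space d) : ENNReal :=
  ∑ i : Fin N, ∑ j ∈ Finset.Ioi i, kernel (r i) (r j)

/-- `E_N(v) = inf_{r₁, …, r_N} { c(r₁, …, r_N) - ∑ᵢ v(rᵢ) }`, in `[-∞, +∞]`. -/
def groundEnergy {d : ℕ} (N : ℕ) (v : Space d → ℝ) : EReal :=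
  ⨅ r : Fin N → Space d, ((cost r : EReal) - ((∑ i, v (r i) : ℝ) : EReal))

/-- The admissible potentials of the dual problem: `v` continuous with `∫ |v| ρ < ∞`. -/
def IsAdmissible {d : ℕ} (ρ v : Space d → ℝ) : Prop :=
  Continuous v ∧ Integrable (fun x => v x * ρ x) volume

/-- The dual functional `E_N(v) + ∫ v ρ`. -/
def dualFunctional {d : ℕ} (N : ℕ) (ρ v : Space d → ℝ) : EReal :=
  groundEnergy N v + ((∫ x, v x * ρ x : ℝ) : EReal)

/-- A Kantorovich potential: a maximizer of the dual functional among admissible potentials. -/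
def IsKantorovichPotential {d : ℕ} (N : ℕ) (ρ v : Space d → ℝ) : Prop :=
  IsAdmissible ρ v ∧ ∀ u : Space d → ℝ, IsAdmissible ρ u →
    dualFunctional N ρ u ≤ dualFunctional N ρ v

/-- The support `Ω` of a density `ρ ≥ 0`, i.e. the support of the measure `ρ(x) dx`. -/
def densitySupport {d : ℕ} (ρ : Space d → ℝ) : Set (Space d) :=
  (volume.withDensity fun x => ENNReal.ofReal (ρ x)).support

/-- A locally finite signed Borel measure `pos - neg` on `ℝ^d` (possibly with infinite total
positive and negative mass), given by its Jordan decomposition: `pos` and `neg` are mutually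
singular locally finite positive measures. In particular the representation is unique. -/
@[ext]
structure SignedRadonMeasure (d : ℕ) where
  pos : Measure (Space d)
  neg : Measure (Space d)
  locallyFinite_pos : IsLocallyFiniteMeasure pos
  locallyFinite_neg : IsLocallyFiniteMeasure neg
  mutuallySingular : pos.MutuallySingular neg

/-- The restriction of a signed measure to a set. -/
def SignedRadonMeasure.restrict {d : ℕ} (μ : SignedRadonMeasure d) (U : Set (Space d)) :
    SignedRadonMeasure d where
  pos := μ.pos.restrict U
  neg := μ.neg.restrict U
  locallyFinite_pos := by
    have := μ.locallyFinite_pos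
    infer_instance
  locallyFinite_neg := by
    have := μ.locallyFinite_neg
    infer_instance
  mutuallySingular := (μ.mutuallySingular.restrict U).symm.restrict U |>.symm

/-- The potential `∫ |x - y|^{2 - d} μ(dy)` of a positive measure, in `[0, +∞]`. -/
def potential {d : ℕ} (μ : Measure (Space d)) (x : Space d) : ENNReal :=
  ∫⁻ y, kernel x y ∂μ

/-- `v` is the Coulomb potential `μ ∗ |x|^{2 - d}` of the signed measure `μ`: at almost every
point the convolution converges absolutely and equals `v`. (For a continuous `v` and a positive
`μ`, this is the same as equality at every point.) -/
def IsCoulombPotential {d : ℕ} (μ : SignedRadonMeasure d) (v : Space d → ℝ) : Prop :=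
  ∀ᵐ x ∂(volume : Measure (Space d)), potential μ.pos x < ⊤ ∧ potential μ.neg x < ⊤ ∧
    v x = (potential μ.pos x).toReal - (potential μ.neg x).toReal

/-- `μ` is a dual charge for `ρ`, with associated potential `v`: the Coulomb potential
`v = μ ∗ |x|^{2 - d}` is a Kantorovich potential. -/
def IsDualCharge {d : ℕ} (N : ℕ) (ρ : Space d → ℝ) (μ : SignedRadonMeasure d)
    (v : Space d → ℝ) : Prop :=
  IsCoulombPotential μ v ∧ IsKantorovichPotential N ρ v

end Coulomb

end

noncomputable section

namespace Coulomb

/-! The dual functional is concave, so two maximizers `v`, `w` can be tested together by adding a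
small bump at a point `x` of the support to their average. The bump strictly raises `∫ u ρ`, so it
must lower the energy. This forces a configuration with a particle near `x` that nearly minimizes
the energy for both potentials (`exists_near_minimizer`). Moving that one particle bounds the
increments of `v` and of `w` from above by the same function, the potential of the other particles.
The Lipschitz bound keeps particles a fixed distance apart, so this function has a second-order
expansion with uniform constants: `v` and `w` share an approximate supergradient at every point of
the support (`exists_common_supergradient`). Cut a segment into `n` steps and bound the increment of
`v` forwards and that of `w` backwards. The gradient terms telescope and the remainders sum to
`O(1/n)`, so `v - w` is constant on every ball inside the support
(`sub_le_sub_of_common_supergradient`). Poisson's equation (`integral_potential_mul_laplacian`),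
tested against smooth functions supported in such a ball, then identifies the charges there.
Countably many balls cover the interior. -/

/-! ### Real-valued cost and finiteness of the ground energy. -/

/-- The real-valued Coulomb kernel, with junk value `0` on the diagonal. -/
def realKernel {d : ℕ} (x y : Space d) : ℝ := (dist x y ^ (d - 2))⁻¹

/-- The real-valued Coulomb cost, meaningful for configurations of distinct points. -/
def realCost {d N : ℕ} (r : Fin N → Space d) : ℝ :=
  ∑ i : Fin N, ∑ j ∈ Finset.Ioi i, realKernel (r i) (r j)

lemma realKernel_nonneg {d : ℕ} (x y : Space d) : 0 ≤ realKernel x y := by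
  unfold realKernel; positivity

lemma realKernel_comm {d : ℕ} (x y : Space d) : realKernel x y = realKernel y x := by
  simp [realKernel, dist_comm]

lemma realCost_nonneg {d N : ℕ} (r : Fin N → Space d) : 0 ≤ realCost r :=
  Finset.sum_nonneg fun _ _ => Finset.sum_nonneg fun _ _ => realKernel_nonneg _ _

lemma kernel_eq_ofReal {d : ℕ} {x y : Space d} (h : x ≠ y) :
    kernel x y = ENNReal.ofReal (realKernel x y) := by
  have : 0 < dist x y := dist_pos.2 h
  rw [kernel, realKernel, edist_dist, ENNReal.ofReal_inv_of_pos (by positivity),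
    ENNReal.ofReal_pow dist_nonneg]

lemma kernel_toReal {d : ℕ} (x y : Space d) : (kernel x y).toReal = realKernel x y := by
  rw [kernel, realKernel, edist_dist, ENNReal.toReal_inv, ENNReal.toReal_pow,
    ENNReal.toReal_ofReal dist_nonneg]

lemma kernel_self {d : ℕ} (hd : 3 ≤ d) (x : Space d) : kernel x x = ⊤ := by
  rw [kernel, edist_self, zero_pow (by omega), ENNReal.inv_zero]

lemma cost_of_injective {d N : ℕ} {r : Fin N → Space d} (hr : Function.Injective r) :
    cost r = ENNReal.ofReal (realCost r) := by
  rw [cost, realCost, ENNReal.ofReal_sum_of_nonneg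
    (fun _ _ => Finset.sum_nonneg fun _ _ => realKernel_nonneg _ _)]
  refine Finset.sum_congr rfl fun i _ => ?_
  rw [ENNReal.ofReal_sum_of_nonneg (fun _ _ => realKernel_nonneg _ _)]
  refine Finset.sum_congr rfl fun j hj => kernel_eq_ofReal fun h => ?_
  exact (Finset.mem_Ioi.1 hj).ne (hr h)

lemma cost_of_not_injective {d N : ℕ} (hd : 3 ≤ d) {r : Fin N → Space d}
    (hr : ¬ Function.Injective r) : cost r = ⊤ := by
  obtain ⟨i, j, hij, hne⟩ : ∃ i j, r i = r j ∧ i < j := by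
    simp only [Function.Injective, not_forall] at hr
    obtain ⟨i, j, h, hne⟩ := hr
    rcases lt_or_gt_of_ne hne with h' | h'
    exacts [⟨i, j, h, h'⟩, ⟨j, i, h.symm, h'⟩]
  refine ENNReal.sum_eq_top.2 ⟨i, Finset.mem_univ _, ENNReal.sum_eq_top.2
    ⟨j, Finset.mem_Ioi.2 hne, ?_⟩⟩
  rw [hij, kernel_self hd]

lemma coe_cost_sub {d N : ℕ} {r : Fin N → Space d} (hr : Function.Injective r) (s : ℝ) :
    (cost r : EReal) - (s : EReal) = ((realCost r - s : ℝ) : EReal) := by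
  rw [cost_of_injective hr, EReal.coe_ennreal_ofReal, max_eq_left (realCost_nonneg r),
    EReal.coe_sub]

/-- Colliding configurations cost `+∞`, so only distinct points need testing, and there the
real-valued cost is the true one. -/
lemma le_groundEnergy {d N : ℕ} (hd : 3 ≤ d) {v : Space d → ℝ} {e : ℝ}
    (h : ∀ r : Fin N → Space d, Function.Injective r → e ≤ realCost r - ∑ i, v (r i)) :
    (e : EReal) ≤ groundEnergy N v := by
  refine le_iInf fun r => ?_
  by_cases hr : Function.Injective r
  · rw [coe_cost_sub hr]
    exact EReal.coe_le_coe_iff.2 (h r hr)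
  · rw [cost_of_not_injective hd hr, EReal.coe_ennreal_top, EReal.top_sub_coe]
    exact le_top

lemma groundEnergy_le {d N : ℕ} {v : Space d → ℝ} {r : Fin N → Space d}
    (hr : Function.Injective r) :
    groundEnergy N v ≤ ((realCost r - ∑ i, v (r i) : ℝ) : EReal) := by
  rw [← coe_cost_sub hr]
  exact iInf_le _ r

lemma exists_norm_eq_one {d : ℕ} (hd : 3 ≤ d) : ∃ e : Space d, ‖e‖ = 1 := by
  refine ⟨EuclideanSpace.single ⟨0, by omega⟩ 1, by simp⟩

lemma dist_add_smul {d : ℕ} {e : Space d} (he : ‖e‖ = 1) (x : Space d) (a b : ℝ) :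
    dist (x + a • e) (x + b • e) = |a - b| := by
  rw [dist_add_left, dist_eq_norm, ← sub_smul, norm_smul, he, mul_one, Real.norm_eq_abs]

/-- Equally spaced points on a line exclude `+∞`. A value `-∞` would lose against the zero
potential, whose dual value is at least `0`. -/
lemma exists_groundEnergy_eq {d N : ℕ} (hd : 3 ≤ d) {ρ v : Space d → ℝ}
    (hv : IsKantorovichPotential N ρ v) : ∃ e : ℝ, groundEnergy N v = e := by
  have htop : groundEnergy N v ≠ ⊤ := by
    obtain ⟨e, he⟩ := exists_norm_eq_one hd
    have hinj : Function.Injective fun k : Fin N => (0 : Space d) + (k : ℝ) • e := by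
      intro k l h
      have := dist_add_smul he 0 (k : ℝ) (l : ℝ)
      rw [show (0 : Space d) + (k : ℝ) • e = 0 + (l : ℝ) • e from h, dist_self, eq_comm, abs_eq_zero, sub_eq_zero, Nat.cast_inj] at this
      exact Fin.ext this
    exact ne_top_of_le_ne_top (EReal.coe_ne_top _) (groundEnergy_le hinj)
  have hbot : groundEnergy N v ≠ ⊥ := by
    intro hb
    have h0 := hv.2 (fun _ => 0) ⟨continuous_const, by simp⟩
    rw [dualFunctional, dualFunctional, hb, EReal.bot_add, le_bot_iff] at h0
    have : ((0 : ℝ) : EReal) ≤ groundEnergy N (fun _ : Space d => (0 : ℝ)) :=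
      le_groundEnergy hd fun r _ => by simpa using realCost_nonneg r
    have h1 : ((0 : ℝ) : EReal) + ((∫ x, (0 : ℝ) * ρ x : ℝ) : EReal) ≤ ⊥ := by
      rw [← h0]; gcongr
    simp at h1
  exact ⟨_, (EReal.coe_toReal htop hbot).symm⟩

/-! ### Common near minimizers from perturbing the average of two maximizers. -/

lemma bump_integral_pos {d : ℕ} {ρ η : Space d → ℝ} (hρ : ∀ᵐ x, 0 ≤ ρ x)
    (hη : ∀ x, 0 ≤ η x) (hint : Integrable fun x => η x * ρ x)
    {x : Space d} (hx : x ∈ densitySupport ρ) {ε : ℝ} (hε : 0 < ε)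
    (hpos : ∀ y ∈ Metric.ball x ε, 0 < η y) : 0 < ∫ y, η y * ρ y := by
  have hnn : 0 ≤ᵐ[volume] fun y => η y * ρ y := by
    filter_upwards [hρ] with y hy using mul_nonneg (hη y) hy
  refine lt_of_le_of_ne (integral_nonneg_of_ae hnn) fun h => ?_
  have h0 := (integral_eq_zero_iff_of_nonneg_ae hnn hint).1 h.symm
  have hball := (Measure.mem_support_iff_forall _).1 hx _ (Metric.ball_mem_nhds x hε)
  refine hball.ne' ?_
  rw [withDensity_apply _ measurableSet_ball]
  refine (setLIntegral_congr_fun_ae measurableSet_ball (g := fun _ => 0) ?_).trans (by simp)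
  filter_upwards [h0] with y hy hyb
  have : ρ y = 0 := (mul_eq_zero.1 hy).resolve_left (hpos y hyb).ne'
  simp [this]

/-- If the dual functional is maximal at `v` and at `w`, then near every point of the support
there is a particle of a configuration that nearly minimizes the energy for both. -/
lemma exists_near_minimizer {d N : ℕ} (hd : 3 ≤ d) (hN : 2 ≤ N) {ρ v w : Space d → ℝ}
    (hρ_int : Integrable ρ volume) (hρ : ∀ᵐ x, 0 ≤ ρ x)
    (hv : IsKantorovichPotential N ρ v) (hw : IsKantorovichPotential N ρ w)
    {ev ew : ℝ} (hev : groundEnergy N v = ev) (hew : groundEnergy N w = ew)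
    {x : Space d} (hx : x ∈ densitySupport ρ) {ε : ℝ} (hε : 0 < ε) :
    ∃ r : Fin N → Space d, Function.Injective r ∧ (∃ i, dist (r i) x < ε) ∧
      realCost r - ∑ i, v (r i) ≤ ev + ε ∧ realCost r - ∑ i, w (r i) ≤ ew + ε := by
  by_contra! hcon
  have hNpos : (0 : ℝ) < N := by exact_mod_cast (by omega : 0 < N)
  have lowv : ∀ r : Fin N → Space d, Function.Injective r → ev ≤ realCost r - ∑ i, v (r i) :=
    fun r hr => by have := groundEnergy_le (v := v) hr; rw [hev] at this; exact_mod_cast this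
  have loww : ∀ r : Fin N → Space d, Function.Injective r → ew ≤ realCost r - ∑ i, w (r i) :=
    fun r hr => by have := groundEnergy_le (v := w) hr; rw [hew] at this; exact_mod_cast this
  -- The bump lives on the `ε`-ball at `x` and has height at most `ε / (2N)`, so `N` particles
  -- collect at most `ε / 2` from it.
  set η : Space d → ℝ := fun y => max 0 (1 / (2 * N) * (ε - dist y x)) with hηdef
  have hη0 : ∀ y, 0 ≤ η y := fun y => le_max_left _ _
  have hηle : ∀ y, η y ≤ ε / (2 * N) := fun y => by
    refine max_le (by positivity) ?_
    rw [div_mul_eq_mul_div, one_mul]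
    gcongr
    linarith [dist_nonneg (x := y) (y := x)]
  have hηout : ∀ y, ε ≤ dist y x → η y = 0 := fun y hy =>
    max_eq_left (mul_nonpos_of_nonneg_of_nonpos (by positivity) (by linarith))
  have hηcont : Continuous η := by fun_prop
  have hηint : Integrable fun y => η y * ρ y := by
    refine hρ_int.bdd_mul (c := ε / (2 * N)) hηcont.aestronglyMeasurable (ae_of_all _ fun y => ?_)
    rw [Real.norm_of_nonneg (hη0 y)]
    exact hηle y
  have hηpos : 0 < ∫ y, η y * ρ y := by
    refine bump_integral_pos hρ hη0 hηint hx hε fun y hy => lt_max_of_lt_right ?_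
    have := Metric.mem_ball.1 hy
    have : 0 < ε - dist y x := by linarith
    positivity
  set u : Space d → ℝ := fun y => (v y + w y) / 2 + η y with hu
  have huρ : (fun y => u y * ρ y) =
      fun y => (v y * ρ y + w y * ρ y) / 2 + η y * ρ y := by
    funext y; simp only [hu]; ring
  have hvw := (hv.1.2.add hw.1.2).div_const 2
  have hadm : IsAdmissible ρ u := by
    refine ⟨?_, ?_⟩
    · have := hv.1.1
      have := hw.1.1
      fun_prop
    · rw [huρ]
      exact hvw.add hηint
  have hlow : (((ev + ew) / 2 : ℝ) : EReal) ≤ groundEnergy N u := by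
    refine le_groundEnergy hd fun r hr => ?_
    have hsum : ∑ i, u (r i) = (∑ i, v (r i) + ∑ i, w (r i)) / 2 + ∑ i, η (r i) := by
      simp only [hu, Finset.sum_add_distrib, ← Finset.sum_div]
    rw [hsum]
    have h1 := lowv r hr
    have h2 := loww r hr
    by_cases hi : ∃ i, dist (r i) x < ε
    · have h3 : ∑ i, η (r i) ≤ ε / 2 := by
        calc ∑ i, η (r i) ≤ ∑ _i : Fin N, ε / (2 * N) := Finset.sum_le_sum fun i _ => hηle _
          _ = ε / 2 := by simp; field_simp
      -- One of the two energies exceeds its infimum by more than `ε`, the other is at least its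
      -- infimum. The average thus gains more than `ε / 2`, which pays for the bump.
      have h4 := hcon r hr hi
      by_cases h5 : realCost r - ∑ i, v (r i) ≤ ev + ε
      · have := h4 h5; linarith
      · linarith
    · push Not at hi
      have h3 : ∑ i, η (r i) = 0 := Finset.sum_eq_zero fun i _ => hηout _ (hi i)
      linarith
  have hInt : ∫ y, u y * ρ y =
      ((∫ y, v y * ρ y) + (∫ y, w y * ρ y)) / 2 + ∫ y, η y * ρ y := by
    rw [huρ]
    refine (integral_add hvw hηint).trans ?_
    congr 1
    refine (integral_div _ _).trans ?_
    congr 1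
    exact integral_add hv.1.2 hw.1.2
  have hmax : ∀ z : Space d → ℝ, ∀ e : ℝ, IsKantorovichPotential N ρ z → groundEnergy N z = e →
      (ev + ew) / 2 + ∫ y, u y * ρ y ≤ e + ∫ y, z y * ρ y := by
    intro z e hz he
    have h := hz.2 u hadm
    rw [dualFunctional, dualFunctional, he] at h
    have h' : (((ev + ew) / 2 : ℝ) : EReal) + ((∫ y, u y * ρ y : ℝ) : EReal) ≤
      (e : EReal) + ((∫ y, z y * ρ y : ℝ) : EReal) := le_trans (by gcongr) h
    exact_mod_cast h'
  have h1 := hmax v ev hv hev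
  have h2 := hmax w ew hw hew
  rw [hInt] at h1 h2
  linarith

/-! ### Moving one particle, and uniform separation. -/

lemma realCost_update_sub {d N : ℕ} (r : Fin N → Space d) (i : Fin N) (y : Space d) :
    realCost (Function.update r i y) - realCost r =
      ∑ j ∈ Finset.univ.erase i, (realKernel y (r j) - realKernel (r i) (r j)) := by
  set D : Fin N → ℝ := fun j => realKernel y (r j) - realKernel (r i) (r j) with hD
  have hform : ∀ s : Fin N → Space d,
      realCost s = ∑ a, ∑ b, if a < b then realKernel (s a) (s b) else 0 := by
    intro s
    refine Finset.sum_congr rfl fun a _ => ?_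
    rw [← Finset.sum_filter]
    exact Finset.sum_congr (by ext; simp) fun _ _ => rfl
  -- Only pairs containing `i` change. They split according to whether `i` is the smaller or the
  -- larger index, and symmetry of the kernel gives the same `D` in both cases.
  have hterm : ∀ a b : Fin N,
      ((if a < b then realKernel (Function.update r i y a) (Function.update r i y b) else 0) -
        if a < b then realKernel (r a) (r b) else 0) =
      (if a = i then (if i < b then D b else 0) else 0) +
        if b = i then (if a < i then D a else 0) else 0 := by
    intro a b
    by_cases hab : a < b
    · rcases eq_or_ne a i with rfl | ha
      · simp [hab, hab.ne', hD]
      · rcases eq_or_ne b i with rfl | hb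
        · simp [hab, ha, hD, realKernel_comm]
        · simp [hab, ha, hb]
    · rcases eq_or_ne a i with rfl | ha
      · by_cases hb : b = a <;> simp [hab, hb]
      · rcases eq_or_ne b i with rfl | hb
        · simp [hab, ha]
        · simp [hab, ha, hb]
  have hsplit : ∑ a, ∑ b, ((if a = i then (if i < b then D b else 0) else 0) +
      if b = i then (if a < i then D a else 0) else 0) = ∑ j ∈ Finset.univ.erase i, D j := by
    simp only [Finset.sum_add_distrib]
    rw [Finset.sum_comm]
    simp only [Finset.sum_ite_eq', Finset.mem_univ, if_true]
    rw [← Finset.sum_add_distrib, ← Finset.add_sum_erase _ _ (Finset.mem_univ i)]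
    simp only [lt_irrefl, if_false, add_zero, zero_add]
    refine Finset.sum_congr rfl fun j hj => ?_
    rcases lt_or_gt_of_ne (Finset.ne_of_mem_erase hj) with h | h <;> simp [h, h.not_gt]
  rw [hform, hform, ← Finset.sum_sub_distrib, ← hsplit]
  refine Finset.sum_congr rfl fun a _ => ?_
  rw [← Finset.sum_sub_distrib]
  exact Finset.sum_congr rfl fun b _ => hterm a b

/-- A nearly minimizing configuration gives, for each of its particles, an approximate
touching of the potential from above by the Coulomb potential of the other particles. -/
lemma sub_le_of_near_minimizer {d N : ℕ} {v : Space d → ℝ} {e ε : ℝ}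
    (hlow : groundEnergy N v = e) {r : Fin N → Space d}
    (hr : Function.Injective r) (hnear : realCost r - ∑ i, v (r i) ≤ e + ε)
    (i : Fin N) (y : Space d) (hy : ∀ j ≠ i, y ≠ r j) :
    v y - v (r i) ≤
      ∑ j ∈ Finset.univ.erase i, (realKernel y (r j) - realKernel (r i) (r j)) + ε := by
  have hinj : Function.Injective (Function.update r i y) := by
    intro a b hab
    by_cases ha : a = i <;> by_cases hb : b = i
    · rw [ha, hb]
    · subst ha; simp only [Function.update_self, Function.update_of_ne hb] at hab
      exact absurd hab (hy b hb)
    · subst hb; simp only [Function.update_self, Function.update_of_ne ha] at hab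
      exact absurd hab.symm (hy a ha)
    · simp only [Function.update_of_ne ha, Function.update_of_ne hb] at hab
      exact hr hab
  have h1 := groundEnergy_le (v := v) hinj
  rw [hlow, EReal.coe_le_coe_iff] at h1
  have h2 : ∑ k, v (Function.update r i y k) = v y + ∑ k ∈ Finset.univ.erase i, v (r k) := by
    rw [← Finset.add_sum_erase _ _ (Finset.mem_univ i), Function.update_self]
    congr 1
    refine Finset.sum_congr rfl fun k hk => ?_
    rw [Function.update_of_ne (Finset.ne_of_mem_erase hk)]
  have h3 := Finset.add_sum_erase Finset.univ (fun k => v (r k)) (Finset.mem_univ i)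
  have h4 := realCost_update_sub r i y
  linarith

/-- Near a given particle there is a place at distance at least one from all other particles. -/
lemma exists_far_point {d N : ℕ} (hd : 3 ≤ d) (r : Fin N → Space d) (i : Fin N) :
    ∃ y, dist y (r i) ≤ 2 * N ∧ ∀ j ≠ i, 1 ≤ dist y (r j) := by
  obtain ⟨e, he⟩ := exists_norm_eq_one hd
  by_contra! hcon
  have hbad : ∀ k : Fin N, ∃ j ≠ i, dist (r i + (2 * (k : ℝ)) • e) (r j) < 1 := by
    intro k
    refine hcon _ ?_
    have := dist_add_smul he (r i) (2 * (k : ℝ)) 0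
    rw [zero_smul, add_zero] at this
    rw [this, sub_zero, abs_of_nonneg (by positivity)]
    have : (k : ℝ) ≤ N := by exact_mod_cast k.2.le
    linarith
  choose f hf hlt using hbad
  -- The `N` candidate sites are at least `2` apart, so no particle is within `1` of two of them.
  -- Being injective on `Fin N`, `f` would hit `i`, which it avoids.
  have hinj : Function.Injective f := by
    intro k l hkl
    by_contra hne
    have h1 := dist_triangle_right (r i + (2 * (k : ℝ)) • e) (r i + (2 * (l : ℝ)) • e) (r (f k))
    rw [dist_add_smul he] at h1
    have h2 := hlt k
    have h3 := hlt l
    rw [← hkl] at h3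
    have h4 : (1 : ℝ) ≤ |(k : ℝ) - l| := by
      have : (1 : ℤ) ≤ |(k : ℤ) - l| := Int.one_le_abs (by
        intro h; apply hne; ext; omega)
      exact_mod_cast this
    have h5 : |2 * (k : ℝ) - 2 * l| = 2 * |(k : ℝ) - l| := by
      rw [← mul_sub, abs_mul, abs_two]
    linarith
  obtain ⟨k, hk⟩ := (Finite.injective_iff_surjective.1 hinj) i
  exact hf k hk

/-- For Lipschitz potentials the particles of a near minimizer are uniformly separated. -/
lemma exists_separation {d N : ℕ} (hd : 3 ≤ d) {v : Space d → ℝ} {e : ℝ} {K : NNReal}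
    (hlow : groundEnergy N v = e) (hK : LipschitzWith K v) :
    ∃ δ > 0, ∀ r : Fin N → Space d, Function.Injective r →
      realCost r - ∑ i, v (r i) ≤ e + 1 → ∀ i j, j ≠ i → δ ≤ dist (r i) (r j) := by
  -- Bounds the repulsion felt by particle `i`: after a move to a far point it is at most `N`, the
  -- potential changes by at most `K * (2 * N)`, and the near-minimality slack is `1`.
  set A : ℝ := N + K * (2 * N) + 1 with hA
  have hA1 : 1 ≤ A := by
    have : (0 : ℝ) ≤ N + K * (2 * N) := by positivity
    linarith
  refine ⟨A⁻¹, by positivity, fun r hr hnear i j hj => ?_⟩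
  obtain ⟨y, hyi, hy⟩ := exists_far_point hd r i
  have h1 := sub_le_of_near_minimizer hlow hr hnear i y fun j hj h => by
    have := hy j hj
    rw [h, dist_self] at this
    linarith
  have h2 : ∑ j ∈ Finset.univ.erase i, realKernel y (r j) ≤ N := by
    calc ∑ j ∈ Finset.univ.erase i, realKernel y (r j)
        ≤ ∑ _j ∈ Finset.univ.erase i, (1 : ℝ) := by
          refine Finset.sum_le_sum fun j hj => ?_
          exact inv_le_one_of_one_le₀ (one_le_pow₀ (hy j (Finset.ne_of_mem_erase hj)))
      _ ≤ ∑ _j : Fin N, (1 : ℝ) :=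
          Finset.sum_le_sum_of_subset_of_nonneg (Finset.subset_univ _) (by simp)
      _ = N := by simp
  have h3 : v (r i) - v y ≤ K * (2 * N) := by
    calc v (r i) - v y ≤ dist (v y) (v (r i)) := by
          rw [dist_comm, Real.dist_eq]; exact le_abs_self _
      _ ≤ K * dist y (r i) := hK.dist_le_mul _ _
      _ ≤ K * (2 * N) := by gcongr
  have h4 : realKernel (r i) (r j) ≤ ∑ j ∈ Finset.univ.erase i, realKernel (r i) (r j) :=
    Finset.single_le_sum (f := fun j => realKernel (r i) (r j))
      (fun _ _ => realKernel_nonneg _ _) (Finset.mem_erase.2 ⟨hj, Finset.mem_univ j⟩)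
  rw [Finset.sum_sub_distrib] at h1
  have h5 : realKernel (r i) (r j) ≤ A := by linarith
  by_contra! hlt
  have hpos : 0 < dist (r i) (r j) := dist_pos.2 fun h => hj (hr h).symm
  have hle1 : dist (r i) (r j) ≤ 1 := hlt.le.trans (inv_le_one_of_one_le₀ hA1)
  -- As `A ≥ 1`, the distance is below `1`, so its power `d - 2 ≥ 1` is no larger than the distance
  -- itself.
  have h6 : dist (r i) (r j) ^ (d - 2) < A⁻¹ :=
    (pow_le_of_le_one hpos.le hle1 (by omega)).trans_lt hlt
  have h7 : A < realKernel (r i) (r j) := by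
    rw [realKernel]
    exact (lt_inv_comm₀ (by positivity) (by positivity)).1 h6
  linarith

/-! ### Uniform Taylor expansion of the kernel. -/

/-- The vector `-z / ‖z‖ ^ 3` is the gradient of the inverse norm. An exact algebraic formula for
the remainder gives an explicit constant depending only on `δ`. -/
lemma inv_norm_add_expansion {E : Type*} [NormedAddCommGroup E] [InnerProductSpace ℝ E]
    {δ : ℝ} (hδ : 0 < δ) {z h : E} (hz : δ ≤ ‖z‖) (hh : ‖h‖ ≤ δ / 2) :
    |‖z + h‖⁻¹ - ‖z‖⁻¹ - inner ℝ (-(‖z‖ ^ 3)⁻¹ • z) h| ≤ 6 / δ ^ 3 * ‖h‖ ^ 2 := by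
  set R := ‖z‖ with hR
  set S := ‖z + h‖ with hS
  set b := ‖h‖ with hb
  set a : ℝ := inner ℝ z h with ha
  have hb0 : 0 ≤ b := norm_nonneg _
  have hSR : |S - R| ≤ b := by
    have := abs_norm_sub_norm_le (z + h) z
    simpa using this
  have hS2 : δ / 2 ≤ S := by have := abs_le.1 hSR; linarith
  have hS0 : 0 < S := by linarith
  have hR0 : 0 < R := by linarith
  have hab : |a| ≤ R * b := abs_real_inner_le_norm z h
  have hsq : S ^ 2 = R ^ 2 + 2 * a + b ^ 2 := norm_add_sq_real z h
  rw [real_inner_smul_left, ← ha]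
  have key : S⁻¹ - R⁻¹ - -(R ^ 3)⁻¹ * a =
      (a * (S - R) * (S + 2 * R) - b ^ 2 * R ^ 2) / (R ^ 3 * S * (R + S)) := by
    have hb2 : b ^ 2 = S ^ 2 - R ^ 2 - 2 * a := by linarith
    rw [hb2]
    field_simp
    ring
  rw [key, abs_div, abs_of_pos (by positivity : 0 < R ^ 3 * S * (R + S)),
    div_le_iff₀ (by positivity)]
  calc |a * (S - R) * (S + 2 * R) - b ^ 2 * R ^ 2|
      ≤ |a * (S - R) * (S + 2 * R)| + |b ^ 2 * R ^ 2| := abs_sub _ _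
    _ = |a| * |S - R| * (S + 2 * R) + b ^ 2 * R ^ 2 := by
        rw [abs_mul, abs_mul, abs_of_pos (by positivity : 0 < S + 2 * R),
          abs_of_nonneg (by positivity : 0 ≤ b ^ 2 * R ^ 2)]
    _ ≤ (R * b) * b * (S + 2 * R) + b ^ 2 * R ^ 2 := by gcongr
    _ ≤ b ^ 2 * (3 * (R * (R + S))) := by nlinarith [mul_nonneg (sq_nonneg b) (mul_pos hR0 hS0).le]
    -- Since `R ≥ δ` and `S ≥ δ / 2`, `R ^ 2 * S ≥ δ ^ 3 / 2`, whence `3 ≤ 6 / δ ^ 3 * (R ^ 2 * S)`.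
    _ ≤ b ^ 2 * ((6 / δ ^ 3 * (R ^ 2 * S)) * (R * (R + S))) := by
        gcongr
        rw [div_mul_eq_mul_div, le_div_iff₀ (by positivity)]
        have : δ ^ 2 * (δ / 2) ≤ R ^ 2 * S := by gcongr
        linarith
    _ = 6 / δ ^ 3 * b ^ 2 * (R ^ 3 * S * (R + S)) := by ring

/-- Uniform second-order expansion of inverse powers of the norm away from the origin. -/
lemma exists_inv_norm_pow_expansion {E : Type*} [NormedAddCommGroup E] [InnerProductSpace ℝ E]
    {δ : ℝ} (hδ : 0 < δ) (m : ℕ) :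
    ∃ C G : ℝ, 0 ≤ C ∧ 0 ≤ G ∧ ∀ z : E, δ ≤ ‖z‖ → ∃ p : E, ‖p‖ ≤ G ∧ ∀ h : E, ‖h‖ ≤ δ / 2 →
      |(‖z + h‖ ^ m)⁻¹ - (‖z‖ ^ m)⁻¹ - inner ℝ p h| ≤ C * ‖h‖ ^ 2 := by
  induction m with
  | zero => exact ⟨0, 0, le_rfl, le_rfl, fun z _ => ⟨0, by simp⟩⟩
  | succ m ih =>
    obtain ⟨C, G, hC, hG, ih⟩ := ih
    set B : ℝ := (δ⁻¹) ^ m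
    set C1 : ℝ := 6 / δ ^ 3
    set G1 : ℝ := (δ ^ 2)⁻¹
    refine ⟨C * (2 * δ⁻¹) + B * C1 + G * (G1 + C1 * δ), B * G1 + δ⁻¹ * G,
      by positivity, by positivity, fun z hz => ?_⟩
    obtain ⟨p, hp, hexp⟩ := ih z hz
    obtain ⟨q, hqdef⟩ : ∃ q : E, q = -(‖z‖ ^ 3)⁻¹ • z := ⟨_, rfl⟩
    have hz0 : 0 < ‖z‖ := by linarith
    have hB : (‖z‖ ^ m)⁻¹ ≤ B := by
      rw [← inv_pow]; exact pow_le_pow_left₀ (by positivity) (by gcongr) m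
    have hzi : ‖z‖⁻¹ ≤ δ⁻¹ := by gcongr
    have hq : ‖q‖ ≤ G1 := by
      simp only [hqdef, norm_smul, norm_neg, norm_inv, norm_pow, norm_norm]
      calc (‖z‖ ^ 3)⁻¹ * ‖z‖ = (‖z‖ ^ 2)⁻¹ := by field_simp
        _ ≤ G1 := by simp only [G1]; gcongr
    refine ⟨(‖z‖ ^ m)⁻¹ • q + ‖z‖⁻¹ • p, ?_, fun h hh => ?_⟩
    · refine (norm_add_le _ _).trans ?_
      rw [norm_smul, norm_smul, Real.norm_of_nonneg (by positivity),
        Real.norm_of_nonneg (by positivity)]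
      gcongr
    · have h1 := hexp h hh
      have h2 := inv_norm_add_expansion hδ hz hh
      rw [← hqdef] at h2
      have hb : 0 ≤ ‖h‖ := norm_nonneg _
      have hS : δ / 2 ≤ ‖z + h‖ := by
        have := norm_sub_le (z + h) h
        rw [add_sub_cancel_right] at this
        linarith
      have hSi : ‖z + h‖⁻¹ ≤ 2 * δ⁻¹ := by
        calc ‖z + h‖⁻¹ ≤ (δ / 2)⁻¹ := by gcongr
          _ = 2 * δ⁻¹ := by rw [inv_div, div_eq_mul_inv]
      have hSi0 : 0 ≤ ‖z + h‖⁻¹ := by positivity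
      have hph : |inner ℝ p h| ≤ G * ‖h‖ := (abs_real_inner_le_norm p h).trans (by gcongr)
      have hqh : |inner ℝ q h| ≤ G1 * ‖h‖ := (abs_real_inner_le_norm q h).trans (by gcongr)
      set X := (‖z + h‖ ^ m)⁻¹ - (‖z‖ ^ m)⁻¹ - inner ℝ p h
      set Y := ‖z + h‖⁻¹ - ‖z‖⁻¹ - inner ℝ q h with hY
      -- Product rule with remainder: `X` and `Y` are the second-order errors of the two factors,
      -- and the last term is the product of two first-order increments.
      have hid : (‖z + h‖ ^ (m + 1))⁻¹ - (‖z‖ ^ (m + 1))⁻¹ -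
          inner ℝ ((‖z‖ ^ m)⁻¹ • q + ‖z‖⁻¹ • p) h =
          X * ‖z + h‖⁻¹ + (‖z‖ ^ m)⁻¹ * Y + inner ℝ p h * (inner ℝ q h + Y) := by
        rw [inner_add_left, real_inner_smul_left, real_inner_smul_left, pow_succ, pow_succ,
          mul_inv, mul_inv]
        simp only [X, Y]
        ring
      rw [hid]
      have hYb : |inner ℝ q h + Y| ≤ (G1 + C1 * δ) * ‖h‖ := by
        refine (abs_add_le _ _).trans ?_
        have : C1 * ‖h‖ ^ 2 ≤ C1 * (δ * ‖h‖) := by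
          have : ‖h‖ ^ 2 ≤ δ * ‖h‖ := by nlinarith
          gcongr
        linarith
      calc |X * ‖z + h‖⁻¹ + (‖z‖ ^ m)⁻¹ * Y + inner ℝ p h * (inner ℝ q h + Y)|
          ≤ |X| * ‖z + h‖⁻¹ + (‖z‖ ^ m)⁻¹ * |Y| + |inner ℝ p h| * |inner ℝ q h + Y| := by
            refine (abs_add_three _ _ _).trans ?_
            rw [abs_mul, abs_mul, abs_mul, abs_of_nonneg hSi0,
              abs_of_nonneg (by positivity : 0 ≤ (‖z‖ ^ m)⁻¹)]
        _ ≤ (C * ‖h‖ ^ 2) * (2 * δ⁻¹) + B * (C1 * ‖h‖ ^ 2) +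
            (G * ‖h‖) * ((G1 + C1 * δ) * ‖h‖) := by gcongr
        _ = _ := by ring

/-! ### Constancy of the difference of two Kantorovich potentials. -/

/-- Two functions with common approximate semiconcave supergradients on a convex set differ by
at most a constant there. -/
lemma sub_le_sub_of_common_supergradient {E : Type*} [NormedAddCommGroup E]
    [InnerProductSpace ℝ E] {B : Set E} (hB : Convex ℝ B) {v w : E → ℝ} {C G δ : ℝ}
    (hδ : 0 < δ)
    (h : ∀ x ∈ B, ∀ ε > 0, ∃ p : E, ‖p‖ ≤ G ∧ ∀ y, ‖y - x‖ ≤ δ →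
      v y - v x ≤ inner ℝ p (y - x) + C * ‖y - x‖ ^ 2 + ε ∧
      w y - w x ≤ inner ℝ p (y - x) + C * ‖y - x‖ ^ 2 + ε)
    {x y : E} (hx : x ∈ B) (hy : y ∈ B) : v y - w y ≤ v x - w x := by
  set D := ‖y - x‖ with hD
  have hbound : ∀ᶠ n : ℕ in Filter.atTop,
      (v y - w y) - (v x - w x) ≤ (2 * G * D + 2 * (C * D ^ 2 + 1)) * (n : ℝ)⁻¹ := by
    obtain ⟨n0, hn0⟩ := exists_nat_gt (D / δ)
    filter_upwards [Filter.eventually_ge_atTop n0, Filter.eventually_gt_atTop 0] with n hn hn1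
    have hnpos : (0 : ℝ) < n := by exact_mod_cast hn1
    set t : ℝ := (n : ℝ)⁻¹ with ht
    have htpos : 0 < t := by positivity
    have htn : n * t = 1 := mul_inv_cancel₀ hnpos.ne'
    have htδ : t * D ≤ δ := by
      have h1 : D / δ < n := hn0.trans_le (by exact_mod_cast hn)
      rw [div_lt_iff₀ hδ] at h1
      calc t * D ≤ t * (n * δ) := by gcongr
        _ = δ := by rw [← mul_assoc, mul_comm t, htn, one_mul]
    set X : ℕ → E := fun k => x + (k * t) • (y - x) with hX
    have hXB : ∀ k, k ≤ n → X k ∈ B := by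
      intro k hk
      refine hB.add_smul_sub_mem hx hy ⟨by positivity, ?_⟩
      rw [← htn]
      gcongr
    -- The tolerance is `t ^ 2`, so that `n = 1 / t` steps accumulate an error of order `t` only.
    choose! p hpG hp using fun k (hk : k ≤ n) => h (X k) (hXB k hk) (t ^ 2) (by positivity)
    have hstep : ∀ k, X (k + 1) - X k = t • (y - x) := by
      intro k
      simp only [hX, add_sub_add_left_eq_sub, ← sub_smul]
      congr 1
      push_cast
      ring
    have hnorm : ‖t • (y - x)‖ = t * D := by rw [norm_smul, Real.norm_of_nonneg htpos.le]
    have hinc : ∀ k, k < n → (v (X (k + 1)) - w (X (k + 1))) - (v (X k) - w (X k)) ≤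
        (inner ℝ (p k) (t • (y - x)) - inner ℝ (p (k + 1)) (t • (y - x))) +
          2 * (C * D ^ 2 + 1) * t ^ 2 := by
      intro k hk
      -- The bound for `v` is taken at `X k` looking forwards, that for `w` at `X (k + 1)` looking
      -- backwards. Their sum bounds the increment of `v - w` and contains `p k - p (k + 1)`, which
      -- telescopes.
      have h1 := (hp k hk.le (X (k + 1)) (by rw [hstep, hnorm]; exact htδ)).1
      have h2 := (hp (k + 1) hk (X k) (by rw [norm_sub_rev, hstep, hnorm]; exact htδ)).2
      rw [← neg_sub (X (k + 1)) (X k), inner_neg_right, norm_neg, hstep, hnorm] at h2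
      rw [hstep, hnorm] at h1
      nlinarith
    have hsum : ∀ k, k ≤ n → (v (X k) - w (X k)) - (v (X 0) - w (X 0)) ≤
        (inner ℝ (p 0) (t • (y - x)) - inner ℝ (p k) (t • (y - x))) +
          k * (2 * (C * D ^ 2 + 1) * t ^ 2) := by
      intro k
      induction k with
      | zero => intro _; simp
      | succ k ih =>
        intro hk
        have h1 := ih (by omega)
        have h2 := hinc k (by omega)
        push_cast
        linarith
    have hfin := hsum n le_rfl
    have hX0 : X 0 = x := by simp [hX]
    have hXn : X n = y := by simp [hX, htn]
    rw [hX0, hXn] at hfin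
    have hin : ∀ k, k ≤ n → |inner ℝ (p k) (t • (y - x))| ≤ G * (t * D) := by
      intro k hk
      refine (abs_real_inner_le_norm _ _).trans ?_
      rw [hnorm]
      have := hpG k hk
      gcongr
    have h1 := (abs_le.1 (hin 0 (by omega))).2
    have h2 := (abs_le.1 (hin n le_rfl)).1
    have h3 : (n : ℝ) * (2 * (C * D ^ 2 + 1) * t ^ 2) = 2 * (C * D ^ 2 + 1) * t := by
      calc (n : ℝ) * (2 * (C * D ^ 2 + 1) * t ^ 2) = 2 * (C * D ^ 2 + 1) * t * (n * t) := by ring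
        _ = _ := by rw [htn, mul_one]
    rw [h3] at hfin
    linarith
  have hlim : Filter.Tendsto
      (fun n : ℕ => (2 * G * D + 2 * (C * D ^ 2 + 1)) * (n : ℝ)⁻¹) Filter.atTop (nhds 0) := by
    simpa using (tendsto_inv_atTop_nhds_zero_nat (𝕜 := ℝ)).const_mul
      (2 * G * D + 2 * (C * D ^ 2 + 1))
  have := ge_of_tendsto hlim hbound
  linarith

/-- The supergradient is the gradient, at the particle near `x`, of the potential of the other
particles. It is the same for `v` and `w` because one configuration nearly minimizes both energies.
-/
lemma exists_common_supergradient {d N : ℕ} (hd : 3 ≤ d) (hN : 2 ≤ N) {ρ v w : Space d → ℝ}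
    (hρ_int : Integrable ρ volume) (hρ : ∀ᵐ x, 0 ≤ ρ x)
    (hv : IsKantorovichPotential N ρ v) (hw : IsKantorovichPotential N ρ w)
    {K L : NNReal} (hK : LipschitzWith K v) (hL : LipschitzWith L w) :
    ∃ C G δ : ℝ, 0 < δ ∧ ∀ x ∈ densitySupport ρ, ∀ ε > 0, ∃ p : Space d, ‖p‖ ≤ G ∧
      ∀ y, ‖y - x‖ ≤ δ →
        v y - v x ≤ inner ℝ p (y - x) + C * ‖y - x‖ ^ 2 + ε ∧
        w y - w x ≤ inner ℝ p (y - x) + C * ‖y - x‖ ^ 2 + ε := by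
  obtain ⟨ev, hev⟩ := exists_groundEnergy_eq hd hv
  obtain ⟨ew, hew⟩ := exists_groundEnergy_eq hd hw
  obtain ⟨δ, hδ, hsep⟩ := exists_separation (N := N) hd hev hK
  obtain ⟨C, G, hC, hG, hexp⟩ := exists_inv_norm_pow_expansion (E := Space d) hδ (d - 2)
  -- The factor `2` comes from recentring the square from `r i` to `x`. The radius `δ / 4` together
  -- with `τ ≤ δ / 4` keeps `y` within `δ / 2` of `r i`.
  refine ⟨2 * (N * C), N * G, δ / 4, by positivity, fun x hx ε hε => ?_⟩
  -- Collects all errors of size `τ`: near-minimality, the Lipschitz shifts of `v` and `w`, and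
  -- recentring the linear and the quadratic terms.
  set A : ℝ := 1 + K + L + N * G + 2 * (N * C)
  have hA : 0 < A := by positivity
  set τ : ℝ := min (min 1 (δ / 4)) (ε / A)
  have hτ : 0 < τ := by positivity
  have hτ1 : τ ≤ 1 := (min_le_left _ _).trans (min_le_left _ _)
  have hτδ : τ ≤ δ / 4 := (min_le_left _ _).trans (min_le_right _ _)
  have hτε : A * τ ≤ ε := by
    have : τ ≤ ε / A := min_le_right _ _
    rwa [le_div_iff₀ hA, mul_comm] at this
  obtain ⟨r, hr, ⟨i, hi⟩, hnv, hnw⟩ :=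
    exists_near_minimizer hd hN hρ_int hρ hv hw hev hew hx hτ
  have hsepr := hsep r hr (by linarith) i
  have hpj : ∀ j, ∃ p : Space d, ‖p‖ ≤ G ∧ (j ≠ i → ∀ h : Space d, ‖h‖ ≤ δ / 2 →
      realKernel (r i + h) (r j) - realKernel (r i) (r j) ≤ inner ℝ p h + C * ‖h‖ ^ 2) := by
    intro j
    by_cases hj : j = i
    · exact ⟨0, by simpa using hG, fun h => absurd hj h⟩
    · obtain ⟨p, hp, hp'⟩ := hexp (r i - r j) (by rw [← dist_eq_norm]; exact hsepr j hj)
      refine ⟨p, hp, fun _ h hh => ?_⟩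
      have := (abs_le.1 (hp' h hh)).2
      rw [realKernel, realKernel, dist_eq_norm, dist_eq_norm, add_sub_right_comm]
      linarith
  choose p hp hp' using hpj
  have hcard : ((Finset.univ.erase i).card : ℝ) ≤ N := by
    exact_mod_cast (Finset.card_le_univ _).trans (Fintype.card_fin N).le
  set P : Space d := ∑ j ∈ Finset.univ.erase i, p j with hP
  have hPG : ‖P‖ ≤ N * G := by
    refine (norm_sum_le_of_le _ fun j _ => hp j).trans ?_
    rw [Finset.sum_const, nsmul_eq_mul]
    gcongr
  have hix : ‖x - r i‖ ≤ τ := by rw [← dist_eq_norm, dist_comm]; exact hi.le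
  refine ⟨P, hPG, fun y hy => ?_⟩
  have hyi : ‖y - r i‖ ≤ ‖y - x‖ + τ := by
    have := norm_add_le (y - x) (x - r i)
    rw [sub_add_sub_cancel] at this
    linarith
  have hyδ : ‖y - r i‖ ≤ δ / 2 := by linarith
  have hfar : ∀ j ≠ i, y ≠ r j := by
    rintro j hj rfl
    have := hsepr j hj
    rw [dist_comm, dist_eq_norm] at this
    linarith
  have hsum : ∑ j ∈ Finset.univ.erase i, (realKernel y (r j) - realKernel (r i) (r j)) ≤
      inner ℝ P (y - r i) + N * C * ‖y - r i‖ ^ 2 := by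
    calc _ ≤ ∑ j ∈ Finset.univ.erase i, (inner ℝ (p j) (y - r i) + C * ‖y - r i‖ ^ 2) := by
          refine Finset.sum_le_sum fun j hj => ?_
          have := hp' j (Finset.ne_of_mem_erase hj) _ hyδ
          rwa [add_sub_cancel] at this
      _ ≤ _ := by
          rw [Finset.sum_add_distrib, ← sum_inner, Finset.sum_const, nsmul_eq_mul, mul_assoc]
          gcongr
  have hin : inner ℝ P (y - r i) ≤ inner ℝ P (y - x) + N * G * τ := by
    have h1 : inner ℝ P (y - r i) = inner ℝ P (y - x) + inner ℝ P (x - r i) := by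
      rw [← inner_add_right, sub_add_sub_cancel]
    have h2 : inner ℝ P (x - r i) ≤ N * G * τ :=
      (real_inner_le_norm _ _).trans (by gcongr)
    linarith
  have hsq : N * C * ‖y - r i‖ ^ 2 ≤ 2 * (N * C) * ‖y - x‖ ^ 2 + 2 * (N * C) * τ := by
    have h1 : ‖y - r i‖ ^ 2 ≤ 2 * ‖y - x‖ ^ 2 + 2 * τ := by
      have : ‖y - r i‖ ^ 2 ≤ (‖y - x‖ + τ) ^ 2 := by gcongr
      nlinarith [sq_nonneg (‖y - x‖ - τ)]
    have h2 : 0 ≤ N * C := by positivity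
    nlinarith
  have lip : ∀ {u : Space d → ℝ} {M : NNReal}, LipschitzWith M u → u (r i) - u x ≤ M * τ := by
    intro u M hM
    calc u (r i) - u x ≤ dist (u (r i)) (u x) := by rw [Real.dist_eq]; exact le_abs_self _
      _ ≤ M * dist (r i) x := hM.dist_le_mul _ _
      _ ≤ M * τ := by gcongr
  have hvK := lip hK
  have hwL := lip hL
  have h1 := sub_le_of_near_minimizer hev hr hnv i y hfar
  have h2 := sub_le_of_near_minimizer hew hr hnw i y hfar
  have hAτ : A * τ = τ + K * τ + L * τ + N * G * τ + 2 * (N * C) * τ := by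
    simp only [A]; ring
  have hKτ : 0 ≤ K * τ := by positivity
  have hLτ : 0 ≤ L * τ := by positivity
  constructor <;> linarith

/-- Kantorovich potentials differ by a constant on convex subsets of the support. -/
lemma sub_eq_sub_of_convex_subset {d N : ℕ} (hd : 3 ≤ d) (hN : 2 ≤ N) {ρ v w : Space d → ℝ}
    (hρ_int : Integrable ρ volume) (hρ : ∀ᵐ x, 0 ≤ ρ x)
    (hv : IsKantorovichPotential N ρ v) (hw : IsKantorovichPotential N ρ w)
    {K L : NNReal} (hK : LipschitzWith K v) (hL : LipschitzWith L w)
    {B : Set (Space d)} (hB : Convex ℝ B) (hBρ : B ⊆ densitySupport ρ) {x y : Space d}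
    (hx : x ∈ B) (hy : y ∈ B) : v x - w x = v y - w y := by
  obtain ⟨C, G, δ, hδ, h⟩ := exists_common_supergradient hd hN hρ_int hρ hv hw hK hL
  have h' := fun x (hx : x ∈ B) => h x (hBρ hx)
  exact le_antisymm (sub_le_sub_of_common_supergradient hB hδ h' hy hx)
    (sub_le_sub_of_common_supergradient hB hδ h' hx hy)

/-! ### The Laplacian and integration by parts. -/

open Filter Topology
open scoped ContDiff

/-- The partial derivative in the `i`-th coordinate direction. -/
def partialDeriv {d : ℕ} (i : Fin d) (f : Space d → ℝ) (x : Space d) : ℝ :=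
  fderiv ℝ f x (EuclideanSpace.single i 1)

/-- The Laplacian, as the sum of the second partial derivatives. -/
def laplacian {d : ℕ} (f : Space d → ℝ) (x : Space d) : ℝ :=
  ∑ i, partialDeriv i (partialDeriv i f) x

lemma contDiff_partialDeriv {d : ℕ} (i : Fin d) {f : Space d → ℝ} (hf : ContDiff ℝ ∞ f) :
    ContDiff ℝ ∞ (partialDeriv i f) :=
  (hf.fderiv_right (m := ∞) (by simp)).clm_apply contDiff_const

lemma contDiff_laplacian {d : ℕ} {f : Space d → ℝ} (hf : ContDiff ℝ ∞ f) :
    ContDiff ℝ ∞ (laplacian f) :=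
  ContDiff.sum fun i _ => contDiff_partialDeriv i (contDiff_partialDeriv i hf)

lemma hasCompactSupport_partialDeriv {d : ℕ} (i : Fin d) {f : Space d → ℝ}
    (hf : HasCompactSupport f) : HasCompactSupport (partialDeriv i f) :=
  hf.fderiv_apply ℝ _

lemma tsupport_laplacian_subset {d : ℕ} (f : Space d → ℝ) :
    tsupport (laplacian f) ⊆ tsupport f := by
  refine closure_minimal (fun x hx => ?_) (isClosed_tsupport f)
  obtain ⟨i, -, hi⟩ := Finset.exists_ne_zero_of_sum_ne_zero (Function.mem_support.1 hx)
  exact tsupport_fderiv_apply_subset ℝ _ (tsupport_fderiv_apply_subset ℝ _ (subset_tsupport _ hi))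

lemma hasCompactSupport_laplacian {d : ℕ} {f : Space d → ℝ}
    (hf : HasCompactSupport f) : HasCompactSupport (laplacian f) :=
  hf.of_isClosed_subset (isClosed_tsupport _) (tsupport_laplacian_subset f)

lemma integral_mul_partialDeriv {d : ℕ} (i : Fin d) {f g : Space d → ℝ} (hf : ContDiff ℝ ∞ f)
    (hg : ContDiff ℝ ∞ g) (hgs : HasCompactSupport g) :
    ∫ x, f x * partialDeriv i g x = - ∫ x, partialDeriv i f x * g x := by
  have hf' := (contDiff_partialDeriv i hf).continuous
  have hg' := (contDiff_partialDeriv i hg).continuous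
  have hgs' := hasCompactSupport_partialDeriv i hgs
  refine integral_mul_fderiv_eq_neg_fderiv_mul_of_integrable ?_ ?_ ?_
    (fun x _ => (hf.differentiable (by simp)).differentiableAt)
    (fun x _ => (hg.differentiable (by simp)).differentiableAt)
  · exact (hf'.mul hg.continuous).integrable_of_hasCompactSupport hgs.mul_left
  · exact (hf.continuous.mul hg').integrable_of_hasCompactSupport hgs'.mul_left
  · exact (hf.continuous.mul hg.continuous).integrable_of_hasCompactSupport hgs.mul_left

lemma integral_mul_laplacian {d : ℕ} {f g : Space d → ℝ} (hf : ContDiff ℝ ∞ f)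
    (hg : ContDiff ℝ ∞ g) (hgs : HasCompactSupport g) :
    ∫ x, f x * laplacian g x = ∫ x, laplacian f x * g x := by
  simp only [laplacian, Finset.mul_sum, Finset.sum_mul]
  rw [integral_finsetSum, integral_finsetSum]
  · refine Finset.sum_congr rfl fun i _ => ?_
    have hf' := contDiff_partialDeriv i hf
    have hg' := contDiff_partialDeriv i hg
    rw [integral_mul_partialDeriv i hf hg' (hasCompactSupport_partialDeriv i hgs),
      integral_mul_partialDeriv i hf' hg hgs, neg_neg]
  · intro i _
    exact ((contDiff_partialDeriv i (contDiff_partialDeriv i hf)).continuous.mul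
      hg.continuous).integrable_of_hasCompactSupport hgs.mul_left
  · intro i _
    exact (hf.continuous.mul (contDiff_partialDeriv i (contDiff_partialDeriv i hg)).continuous
      ).integrable_of_hasCompactSupport (hasCompactSupport_partialDeriv i
        (hasCompactSupport_partialDeriv i hgs)).mul_left

/-- Makes an additive constant in a potential invisible to Poisson's equation. -/
lemma integral_laplacian_eq_zero {d : ℕ} {g : Space d → ℝ}
    (hg : ContDiff ℝ ∞ g) (hgs : HasCompactSupport g) : ∫ x, laplacian g x = 0 := by
  have h := integral_mul_laplacian (f := fun _ => (1 : ℝ)) contDiff_const hg hgs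
  have h1 : ∀ x : Space d, laplacian (fun _ : Space d => (1 : ℝ)) x = 0 := by
    intro x
    refine Finset.sum_eq_zero fun i _ => ?_
    have : partialDeriv i (fun _ : Space d => (1 : ℝ)) = fun _ => 0 := by
      funext y; simp [partialDeriv]
    rw [this]; simp [partialDeriv]
  simpa [h1] using h

/-! ### The fundamental solution by regularization. -/

lemma contDiff_regularized {d : ℕ} (y : Space d) {a : ℝ} (ha : 0 < a) (s : ℝ) :
    ContDiff ℝ ∞ fun x : Space d => (‖x - y‖ ^ 2 + a) ^ s := by
  refine ContDiff.rpow_const_of_ne ?_ fun x => by positivity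
  exact ((contDiff_id.sub contDiff_const).norm_sq ℝ).add contDiff_const

lemma partialDeriv_regularized {d : ℕ} (y : Space d) {a : ℝ} (ha : 0 < a) (s : ℝ) (i : Fin d)
    (x : Space d) : partialDeriv i (fun x : Space d => (‖x - y‖ ^ 2 + a) ^ s) x =
      2 * s * ((x i - y i) * (‖x - y‖ ^ 2 + a) ^ (s - 1)) := by
  have h1 : HasFDerivAt (fun x : Space d => ‖x - y‖ ^ 2 + a) (2 • innerSL ℝ (x - y)) x := by
    have := (hasStrictFDerivAt_norm_sq (x - y)).hasFDerivAt.comp x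
      ((hasFDerivAt_id x).sub_const y)
    simpa using this.add_const a
  have h2 := h1.rpow_const (p := s) (Or.inl (by positivity))
  have h3 : inner ℝ (x - y) (EuclideanSpace.single i (1 : ℝ)) = x i - y i := by
    rw [EuclideanSpace.inner_single_right]; simp
  rw [partialDeriv, h2.fderiv]
  simp only [smul_apply, innerSL_apply_apply, h3, smul_eq_mul, nsmul_eq_mul,
    Nat.cast_ofNat]
  ring

lemma partialDeriv_partialDeriv_regularized {d : ℕ} (y : Space d) {a : ℝ} (ha : 0 < a) (s : ℝ)
    (i : Fin d) (x : Space d) :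
    partialDeriv i (partialDeriv i fun x : Space d => (‖x - y‖ ^ 2 + a) ^ s) x =
      2 * s * ((‖x - y‖ ^ 2 + a) ^ (s - 1) +
        2 * (s - 1) * ((x i - y i) ^ 2 * (‖x - y‖ ^ 2 + a) ^ (s - 2))) := by
  have hfun : partialDeriv i (fun x : Space d => (‖x - y‖ ^ 2 + a) ^ s) =
      fun x => 2 * s * ((x i - y i) * (‖x - y‖ ^ 2 + a) ^ (s - 1)) :=
    funext (partialDeriv_regularized y ha s i)
  have hd1 : HasFDerivAt (fun x : Space d => x i - y i)
      (EuclideanSpace.proj i : Space d →L[ℝ] ℝ) x :=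
    ((EuclideanSpace.proj i : Space d →L[ℝ] ℝ).hasFDerivAt).sub_const (y i)
  have hd2 := ((contDiff_regularized y ha (s - 1)).differentiable (by simp) x).hasFDerivAt
  have h3 := partialDeriv_regularized y ha (s - 1) i x
  rw [partialDeriv] at h3
  have h4 : HasFDerivAt (fun x : Space d => 2 * s * ((x i - y i) * (‖x - y‖ ^ 2 + a) ^ (s - 1)))
      _ x := (hd1.mul hd2).const_mul (2 * s)
  rw [hfun, partialDeriv, h4.fderiv]
  simp only [smul_apply, add_apply, smul_eq_mul, h3]
  have h5 : (EuclideanSpace.proj i : Space d →L[ℝ] ℝ) (EuclideanSpace.single i 1) = 1 := by simp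
  rw [show s - 1 - 1 = s - 2 by ring, h5]
  ring

/-- With exponent `1 - d / 2` the `‖x - y‖ ^ 2` contributions cancel. What remains is a negative
multiple of a peak that concentrates at `y` as `a → 0`. -/
lemma laplacian_regularized {d : ℕ} (y : Space d) {a : ℝ} (ha : 0 < a) (x : Space d) :
    laplacian (fun x : Space d => (‖x - y‖ ^ 2 + a) ^ (1 - (d : ℝ) / 2)) x =
      -(d * (d - 2) * (a * (‖x - y‖ ^ 2 + a) ^ (-((d : ℝ) + 2) / 2))) := by
  have hS : 0 < ‖x - y‖ ^ 2 + a := by positivity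
  simp only [laplacian, partialDeriv_partialDeriv_regularized y ha]
  rw [← Finset.mul_sum, Finset.sum_add_distrib, ← Finset.mul_sum, ← Finset.sum_mul]
  have hn : ∑ i, (x i - y i) ^ 2 = ‖x - y‖ ^ 2 := by
    rw [EuclideanSpace.norm_sq_eq]; simp
  rw [hn]
  simp only [Finset.sum_const, Finset.card_univ, Fintype.card_fin, nsmul_eq_mul]
  have e1 : (‖x - y‖ ^ 2 + a) ^ (1 - (d : ℝ) / 2 - 1) =
      (‖x - y‖ ^ 2 + a) ^ (-((d : ℝ) + 2) / 2) * (‖x - y‖ ^ 2 + a) := by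
    rw [← Real.rpow_add_one hS.ne']; congr 1; ring
  have e2 : 1 - (d : ℝ) / 2 - 2 = -((d : ℝ) + 2) / 2 := by ring
  rw [e1, e2]
  ring

/-- The mass of the unnormalized peak function in the regularized fundamental solution. -/
def peakMass (d : ℕ) : ℝ := ∫ x : Space d, (1 + ‖x‖ ^ 2) ^ (-((d : ℝ) + 2) / 2)

lemma integrable_peak (d : ℕ) :
    Integrable fun x : Space d => (1 + ‖x‖ ^ 2) ^ (-((d : ℝ) + 2) / 2) :=
  integrable_rpow_neg_one_add_norm_sq (by simp)

lemma peakMass_pos (d : ℕ) : 0 < peakMass d := by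
  refine (integral_pos_iff_support_of_nonneg (fun x => by positivity) (integrable_peak d)).2 ?_
  have : Function.support (fun x : Space d => (1 + ‖x‖ ^ 2) ^ (-((d : ℝ) + 2) / 2)) = Set.univ :=
    Set.eq_univ_of_forall fun x => (by positivity : (1 + ‖x‖ ^ 2) ^ (-((d : ℝ) + 2) / 2) ≠ 0)
  rw [this]
  exact Measure.measure_univ_pos.2 (NeZero.ne _)

lemma tendsto_peak {d : ℕ} {g : Space d → ℝ} (hg : Continuous g)
    (hgs : HasCompactSupport g) (y : Space d) :
    Tendsto (fun c : ℝ => ∫ x, ((c⁻¹) ^ 2 * (‖x - y‖ ^ 2 + (c⁻¹) ^ 2) ^ (-((d : ℝ) + 2) / 2)) * g x)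
      atTop (𝓝 (peakMass d * g y)) := by
  have hI := peakMass_pos d
  have hpeak := tendsto_integral_comp_smul_smul_of_integrable' (μ := volume)
    (φ := fun x : Space d => (peakMass d)⁻¹ * (1 + ‖x‖ ^ 2) ^ (-((d : ℝ) + 2) / 2))
    (fun x => by positivity)
    (by rw [integral_const_mul]; exact inv_mul_cancel₀ hI.ne') ?_ (g := g) (x₀ := y)
    (hg.integrable_of_hasCompactSupport hgs) hg.continuousAt
  · have := hpeak.const_mul (peakMass d)
    refine this.congr' ?_
    -- With `a = c⁻¹ ^ 2`, the dilated peak carries `c ^ d * c ^ (-(d + 2)) = c⁻¹ ^ 2`, the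
    -- prefactor in the statement.
    filter_upwards [eventually_gt_atTop 0] with c hc
    rw [← integral_const_mul]
    refine integral_congr_ae (ae_of_all _ fun x => ?_)
    simp only [finrank_euclideanSpace, Fintype.card_fin, smul_eq_mul]
    have h1 : ‖c • (y - x)‖ ^ 2 = c ^ 2 * ‖x - y‖ ^ 2 := by
      rw [norm_smul, mul_pow, norm_sub_rev, Real.norm_eq_abs, sq_abs]
    have h2 : 1 + c ^ 2 * ‖x - y‖ ^ 2 = c ^ 2 * (‖x - y‖ ^ 2 + c⁻¹ ^ 2) := by
      field_simp; ring
    have h3 : (c ^ 2) ^ (-((d : ℝ) + 2) / 2) = (c ^ (d + 2))⁻¹ := by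
      rw [← Real.rpow_natCast c 2, ← Real.rpow_mul hc.le, ← Real.rpow_natCast, ← Real.rpow_neg hc.le]
      congr 1; push_cast; ring
    rw [h1, h2, Real.mul_rpow (by positivity) (by positivity), h3]
    field_simp
    ring
  · have hlim : Tendsto (fun x : Space d => (peakMass d)⁻¹ * ‖x‖⁻¹) (Bornology.cobounded _) (𝓝 0) := by
      simpa using (tendsto_inv_atTop_zero.comp tendsto_norm_cobounded_atTop).const_mul
        (peakMass d)⁻¹
    refine squeeze_zero' (Eventually.of_forall fun x => by positivity) ?_ hlim
    filter_upwards [tendsto_norm_cobounded_atTop.eventually_ge_atTop 1] with x hx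
    have hx0 : 0 < ‖x‖ := by linarith
    have h1 : (1 + ‖x‖ ^ 2) ^ (-((d : ℝ) + 2) / 2) ≤ (‖x‖ ^ (d + 2))⁻¹ := by
      calc (1 + ‖x‖ ^ 2) ^ (-((d : ℝ) + 2) / 2) ≤ (‖x‖ ^ 2) ^ (-((d : ℝ) + 2) / 2) := by
            refine Real.rpow_le_rpow_of_nonpos (by positivity) (by linarith) ?_
            have : (0 : ℝ) ≤ d := by positivity
            linarith
        _ = (‖x‖ ^ (d + 2))⁻¹ := by
            rw [← Real.rpow_natCast ‖x‖ 2, ← Real.rpow_mul hx0.le, ← Real.rpow_natCast,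
              ← Real.rpow_neg hx0.le]
            congr 1; push_cast; ring
    calc ‖x‖ ^ Module.finrank ℝ (Space d) *
          ((peakMass d)⁻¹ * (1 + ‖x‖ ^ 2) ^ (-((d : ℝ) + 2) / 2))
        ≤ ‖x‖ ^ d * ((peakMass d)⁻¹ * (‖x‖ ^ (d + 2))⁻¹) := by
          rw [finrank_euclideanSpace, Fintype.card_fin]; gcongr
      _ = (peakMass d)⁻¹ * (‖x‖ ^ 2)⁻¹ := by rw [pow_add]; field_simp
      _ ≤ (peakMass d)⁻¹ * ‖x‖⁻¹ := by
          gcongr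
          nlinarith

lemma realKernel_eq_rpow {d : ℕ} (hd : 3 ≤ d) (x y : Space d) :
    realKernel x y = (‖x - y‖ ^ 2) ^ (1 - (d : ℝ) / 2) := by
  rw [realKernel, dist_eq_norm, ← Real.rpow_natCast ‖x - y‖ 2, ← Real.rpow_mul (norm_nonneg _),
    ← Real.rpow_natCast, ← Real.rpow_neg (norm_nonneg _)]
  congr 1
  rw [Nat.cast_sub (by omega)]
  push_cast
  ring

lemma measurable_kernel {d : ℕ} : Measurable fun p : Space d × Space d => kernel p.1 p.2 := by
  unfold kernel
  fun_prop

lemma measurable_realKernel {d : ℕ} :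
    Measurable fun p : Space d × Space d => realKernel p.1 p.2 := by
  unfold realKernel
  fun_prop

lemma integrableOn_realKernel {d : ℕ} (hd : 3 ≤ d) (y : Space d) (R : ℝ) :
    IntegrableOn (fun x => realKernel x y) (Metric.ball y R) := by
  have h0 : IntegrableOn (fun x : Space d => realKernel x 0) (Metric.ball 0 R) := by
    have hmeas : Measurable fun x : Space d => realKernel x 0 := by
      unfold realKernel
      fun_prop
    have hfin : Module.finrank ℝ (Space d) = d := finrank_euclideanSpace_fin
    have hdecay : ∀ x : Space d, ‖realKernel x 0‖ ≤ 1 * ‖x‖ ^ (-((d : ℝ) - 2)) := by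
      intro x
      rw [Real.norm_of_nonneg (realKernel_nonneg _ _), one_mul, realKernel, dist_zero_right,
        Real.rpow_neg (norm_nonneg _), ← Real.rpow_natCast, Nat.cast_sub (by omega)]
      simp
    exact integrableOn_ball_of_norm_le_rpow (E := Space d) (F := ℝ) (μ := volume)
      (f := fun x => realKernel x 0) (C := 1) (α := (d : ℝ) - 2)
      (by rw [hfin]; omega) (by rw [hfin]; linarith) (ae_of_all _ hdecay)
      hmeas.aestronglyMeasurable
  have h1 := (integrable_indicator_iff measurableSet_ball).2 h0
  have h2 := h1.comp_sub_right y
  refine (integrable_indicator_iff measurableSet_ball).1 (h2.congr (ae_of_all _ fun x => ?_))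
  simp [Set.indicator, realKernel, dist_eq_norm]

lemma integrable_realKernel_mul {d : ℕ} (hd : 3 ≤ d) (y : Space d) {g : Space d → ℝ}
    (hg : Continuous g) (hgs : HasCompactSupport g) :
    Integrable fun x => realKernel x y * g x := by
  obtain ⟨R, hR⟩ := hgs.isCompact.isBounded.subset_ball y
  obtain ⟨M, hM⟩ := hg.bounded_above_of_compact_support hgs
  have h1 := (integrableOn_realKernel hd y R).mul_bdd (g := g) (c := M) hg.aestronglyMeasurable (ae_of_all _ hM)
  refine (integrableOn_iff_integrable_of_support_subset ?_).1 h1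
  intro x hx
  exact hR (subset_tsupport _ (right_ne_zero_of_mul hx))

/-- The Coulomb kernel is a multiple of the fundamental solution of the Laplacian. -/
lemma integral_realKernel_mul_laplacian {d : ℕ} (hd : 3 ≤ d) {g : Space d → ℝ}
    (hg : ContDiff ℝ ∞ g) (hgs : HasCompactSupport g) (y : Space d) :
    ∫ x, realKernel x y * laplacian g x = -(d * (d - 2) * peakMass d) * g y := by
  have hexp : 1 - (d : ℝ) / 2 ≤ 0 := by
    have : (3 : ℝ) ≤ d := by exact_mod_cast hd
    linarith
  have hLc := (contDiff_laplacian hg).continuous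
  have hLs := hasCompactSupport_laplacian hgs
  -- On the diagonal `realKernel` has value `0` and cannot dominate the regularized kernels; off it,
  -- the exponent is nonpositive and it does.
  have hne : ∀ᵐ x : Space d, x ≠ y := by
    have : Nonempty (Fin d) := ⟨⟨0, by omega⟩⟩
    exact Measure.ae_ne volume y
  have hL : Tendsto (fun c : ℝ => ∫ x, (‖x - y‖ ^ 2 + c⁻¹ ^ 2) ^ (1 - (d : ℝ) / 2) * laplacian g x)
      atTop (𝓝 (∫ x, realKernel x y * laplacian g x)) := by
    refine tendsto_integral_filter_of_dominated_convergence
      (fun x => ‖realKernel x y * laplacian g x‖) ?_ ?_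
      (integrable_realKernel_mul hd y hLc hLs).norm ?_
    · filter_upwards [eventually_gt_atTop 0] with c hc
      exact ((contDiff_regularized y (by positivity) _).continuous.mul hLc).aestronglyMeasurable
    · filter_upwards [eventually_gt_atTop 0] with c hc
      filter_upwards [hne] with x hx
      have hxy : 0 < ‖x - y‖ := norm_pos_iff.2 (sub_ne_zero.2 hx)
      rw [norm_mul, norm_mul, Real.norm_of_nonneg (by positivity),
        Real.norm_of_nonneg (realKernel_nonneg _ _), realKernel_eq_rpow hd]
      refine mul_le_mul_of_nonneg_right ?_ (norm_nonneg _)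
      refine Real.rpow_le_rpow_of_nonpos (by positivity) ?_ hexp
      have := sq_nonneg c⁻¹
      linarith
    · filter_upwards [hne] with x hx
      have hxy : 0 < ‖x - y‖ := norm_pos_iff.2 (sub_ne_zero.2 hx)
      refine Tendsto.mul_const _ ?_
      rw [realKernel_eq_rpow hd]
      refine Tendsto.rpow_const ?_ (Or.inl (by positivity))
      have h0 : Tendsto (fun c : ℝ => c⁻¹ ^ 2) atTop (𝓝 0) := by
        simpa using (tendsto_inv_atTop_zero (𝕜 := ℝ)).pow 2
      simpa using h0.const_add (‖x - y‖ ^ 2)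
  have hR := (tendsto_peak hg.continuous hgs y).const_mul (-((d : ℝ) * (d - 2)))
  refine (tendsto_nhds_unique hL (hR.congr' ?_)).trans (by ring)
  filter_upwards [eventually_gt_atTop 0] with c hc
  rw [integral_mul_laplacian (contDiff_regularized y (by positivity) _) hg hgs,
    ← integral_const_mul]
  refine integral_congr_ae (ae_of_all _ fun x => ?_)
  simp only [laplacian_regularized y (by positivity : 0 < c⁻¹ ^ 2)]
  ring

/-! ### Local integrability of potentials and Poisson's equation. -/

lemma exists_lintegral_kernel_ball_le {d : ℕ} (hd : 3 ≤ d) (R : ℝ) :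
    ∃ I : ENNReal, I < ⊤ ∧ ∀ y : Space d, ∫⁻ x in Metric.ball y R, kernel x y = I := by
  have : Nonempty (Fin d) := ⟨⟨0, by omega⟩⟩
  refine ⟨∫⁻ x in Metric.ball (0 : Space d) R, kernel x 0, ?_, fun y => ?_⟩
  · have h := (integrableOn_realKernel hd (0 : Space d) R).lintegral_lt_top
    refine (lintegral_congr_ae ?_).trans_lt h
    filter_upwards [ae_restrict_of_ae (Measure.ae_ne (volume : Measure (Space d)) 0)] with x hx
      using kernel_eq_ofReal hx
  · rw [← lintegral_indicator measurableSet_ball, ← lintegral_indicator measurableSet_ball,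
      
      ← lintegral_sub_right_eq_self
        (fun x => (Metric.ball (0 : Space d) R).indicator (fun x => kernel x 0) x) y]
    refine lintegral_congr fun x => ?_
    simp [Set.indicator, kernel, edist_eq_enorm_sub, dist_eq_norm]

lemma measurable_kernel_right {d : ℕ} (x : Space d) : Measurable fun y => kernel x y := by
  unfold kernel
  fun_prop

lemma measurable_potential {d : ℕ} (α : Measure (Space d)) [SFinite α] :
    Measurable (potential α) :=
  measurable_kernel.lintegral_prod_right'

/-- A Coulomb potential that is finite at one point is locally integrable. -/
lemma setLIntegral_potential_lt_top {d : ℕ} (hd : 3 ≤ d) (α : Measure (Space d))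
    [IsLocallyFiniteMeasure α] {x₀ : Space d} (hx₀ : potential α x₀ < ⊤) {R : ℝ} :
    ∫⁻ x in Metric.ball x₀ R, potential α x < ⊤ := by
  obtain ⟨I, hI, hIy⟩ := exists_lintegral_kernel_ball_le hd (3 * R)
  set M : ENNReal := 2 ^ (d - 2) * volume (Metric.ball x₀ R)
  have hM : M < ⊤ := ENNReal.mul_lt_top (by simp) measure_ball_lt_top
  -- For `y` near `x₀` the ball lies in `Metric.ball y (3 * R)`. For `y` far away, `x₀` is at most
  -- twice as far from `y` as `x` is, so the kernel at `x` is controlled by the one at `x₀`.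
  have hinner : ∀ y, ∫⁻ x in Metric.ball x₀ R, kernel x y ≤
      (Metric.ball x₀ (2 * R)).indicator (fun _ => I) y + M * kernel x₀ y := by
    intro y
    by_cases hy : y ∈ Metric.ball x₀ (2 * R)
    · rw [Set.indicator_of_mem hy, ← hIy y]
      refine (lintegral_mono_set fun x hx => ?_).trans le_self_add
      rw [Metric.mem_ball] at *
      linarith [dist_triangle_right x y x₀]
    · rw [Set.indicator_of_notMem hy, zero_add]
      calc ∫⁻ x in Metric.ball x₀ R, kernel x y
          ≤ ∫⁻ x in Metric.ball x₀ R, 2 ^ (d - 2) * kernel x₀ y := by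
            refine setLIntegral_mono' measurableSet_ball fun x hx => ?_
            rw [Metric.mem_ball] at hx hy
            have hle : edist x₀ y ≤ 2 * edist x y := by
              have h2 : 2 * ENNReal.ofReal (dist x y) = ENNReal.ofReal (2 * dist x y) := by
                rw [ENNReal.ofReal_mul two_pos.le, ENNReal.ofReal_ofNat]
              rw [edist_dist, edist_dist, h2]
              refine ENNReal.ofReal_le_ofReal ?_
              have h1 := dist_triangle_left x₀ y x
              rw [dist_comm y x₀] at hy
              linarith
            rw [kernel, kernel, ← ENNReal.inv_le_inv, ENNReal.mul_inv (by simp) (by simp),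
              inv_inv, inv_inv]
            rw [mul_comm, ← div_eq_mul_inv]
            refine ENNReal.div_le_of_le_mul ?_
            rw [mul_comm, ← mul_pow]
            gcongr
        _ = M * kernel x₀ y := by
            rw [lintegral_const, Measure.restrict_apply_univ]
            simp only [M]
            ring
  calc ∫⁻ x in Metric.ball x₀ R, potential α x
      = ∫⁻ y, (∫⁻ x in Metric.ball x₀ R, kernel x y) ∂α :=
        lintegral_lintegral_swap measurable_kernel.aemeasurable
    _ ≤ ∫⁻ y, ((Metric.ball x₀ (2 * R)).indicator (fun _ => I) y + M * kernel x₀ y) ∂α :=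
        lintegral_mono hinner
    _ = I * α (Metric.ball x₀ (2 * R)) + M * potential α x₀ := by
        have hk := measurable_kernel_right x₀
        rw [lintegral_add_right _ (hk.const_mul M), lintegral_const_mul _ hk,
          lintegral_indicator_const measurableSet_ball, potential]
    _ < ⊤ := ENNReal.add_lt_top.2
        ⟨ENNReal.mul_lt_top hI measure_ball_lt_top, ENNReal.mul_lt_top hM hx₀⟩

/-- Justifies exchanging the integrals in Poisson's equation, even when `α` has infinite mass. -/
lemma integrable_prod_realKernel_mul {d : ℕ} (hd : 3 ≤ d) (α : Measure (Space d))
    [IsLocallyFiniteMeasure α] (hα : ∀ᵐ x, potential α x < ⊤) {g : Space d → ℝ}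
    (hg : Continuous g) (hgs : HasCompactSupport g) :
    Integrable (fun p : Space d × Space d => realKernel p.1 p.2 * g p.1) (volume.prod α) := by
  obtain ⟨x₀, hx₀⟩ := hα.exists
  obtain ⟨R, hR⟩ := hgs.isCompact.isBounded.subset_ball x₀
  obtain ⟨M, hM⟩ := hg.bounded_above_of_compact_support hgs
  have hmeas : Measurable fun p : Space d × Space d => realKernel p.1 p.2 * g p.1 :=
    measurable_realKernel.mul (hg.measurable.comp measurable_fst)
  refine ⟨hmeas.aestronglyMeasurable, ?_⟩
  rw [HasFiniteIntegral, lintegral_prod _ hmeas.enorm.aemeasurable]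
  calc ∫⁻ x, ∫⁻ y, ‖realKernel x y * g x‖ₑ ∂α
      ≤ ∫⁻ x, (Metric.ball x₀ R).indicator (fun x => ENNReal.ofReal M * potential α x) x := by
        refine lintegral_mono fun x => ?_
        by_cases hx : x ∈ Metric.ball x₀ R
        · rw [Set.indicator_of_mem hx, potential,
            ← lintegral_const_mul _ (measurable_kernel_right x)]
          refine lintegral_mono fun y => ?_
          rw [enorm_mul, mul_comm]
          refine mul_le_mul' ?_ ?_
          · rw [← ofReal_norm]
            exact ENNReal.ofReal_le_ofReal (hM x)
          · rw [← kernel_toReal, Real.enorm_of_nonneg ENNReal.toReal_nonneg]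
            exact ENNReal.ofReal_toReal_le
        · have : g x = 0 := by
            by_contra h
            exact hx (hR (subset_tsupport _ h))
          simp [this]
    _ = ENNReal.ofReal M * ∫⁻ x in Metric.ball x₀ R, potential α x := by
        rw [lintegral_indicator measurableSet_ball,
          lintegral_const_mul _ (measurable_potential α)]
    _ < ⊤ := ENNReal.mul_lt_top ENNReal.ofReal_lt_top (setLIntegral_potential_lt_top hd α hx₀)

lemma integral_realKernel_eq_potential {d : ℕ} (α : Measure (Space d)) {x : Space d}
    (hx : potential α x < ⊤) : ∫ y, realKernel x y ∂α = (potential α x).toReal := by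
  have hk := measurable_kernel_right x
  simp only [← kernel_toReal]
  exact integral_toReal hk.aemeasurable (ae_lt_top hk hx.ne)

lemma integrable_potential_mul {d : ℕ} (hd : 3 ≤ d) (α : Measure (Space d))
    [IsLocallyFiniteMeasure α] (hα : ∀ᵐ x, potential α x < ⊤) {g : Space d → ℝ}
    (hg : Continuous g) (hgs : HasCompactSupport g) :
    Integrable fun x => (potential α x).toReal * g x := by
  refine (integrable_prod_realKernel_mul hd α hα hg hgs).integral_prod_left.congr ?_
  filter_upwards [hα] with x hx
  rw [integral_mul_const, integral_realKernel_eq_potential α hx]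

/-- Poisson's equation, in the sense of distributions. -/
lemma integral_potential_mul_laplacian {d : ℕ} (hd : 3 ≤ d) (α : Measure (Space d))
    [IsLocallyFiniteMeasure α] (hα : ∀ᵐ x, potential α x < ⊤) {g : Space d → ℝ}
    (hg : ContDiff ℝ ∞ g) (hgs : HasCompactSupport g) :
    ∫ x, (potential α x).toReal * laplacian g x =
      -(d * (d - 2) * peakMass d) * ∫ y, g y ∂α := by
  have hint := integrable_prod_realKernel_mul hd α hα (contDiff_laplacian hg).continuous
    (hasCompactSupport_laplacian hgs)
  calc ∫ x, (potential α x).toReal * laplacian g x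
      = ∫ x, ∫ y, realKernel x y * laplacian g x ∂α := by
        refine integral_congr_ae ?_
        filter_upwards [hα] with x hx
        rw [integral_mul_const, integral_realKernel_eq_potential α hx]
    _ = ∫ y, (∫ x, realKernel x y * laplacian g x) ∂α :=
        integral_integral_swap (f := fun x y => realKernel x y * laplacian g x) hint
    _ = _ := by
        simp only [integral_realKernel_mul_laplacian hd hg hgs]
        rw [integral_const_mul]

/-! ### Recovering signed measures from their potentials. -/

/-- Locally finite measures are determined on an open set by the integrals of the smooth
functions compactly supported in that set. -/
lemma restrict_eq_of_integral_contDiff_eq {d : ℕ} {α β : Measure (Space d)}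
    [IsLocallyFiniteMeasure α] [IsLocallyFiniteMeasure β] {B : Set (Space d)} (hB : IsOpen B)
    (h : ∀ g : Space d → ℝ, ContDiff ℝ ∞ g → HasCompactSupport g → tsupport g ⊆ B →
      ∫ x, g x ∂α = ∫ x, g x ∂β) : α.restrict B = β.restrict B := by
  -- Both measures have locally integrable densities with respect to `σ`, so the fundamental lemma
  -- of the calculus of variations applies to the difference of densities.
  set σ := α + β
  have hασ : α ≪ σ := Measure.AbsolutelyContinuous.rfl.add_right β
  have hβσ : β ≪ σ := by
    rw [show σ = β + α from add_comm _ _]; exact Measure.AbsolutelyContinuous.rfl.add_right α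
  have hloc : ∀ γ : Measure (Space d), IsLocallyFiniteMeasure γ →
      LocallyIntegrable (fun x => (γ.rnDeriv σ x).toReal) σ := by
    intro γ hγ
    rw [locallyIntegrable_iff]
    intro k hk
    exact Measure.integrableOn_toReal_rnDeriv hk.measure_lt_top.ne
  have hae := hB.ae_eq_zero_of_integral_contDiff_smul_eq_zero (μ := σ)
    (f := fun x => (α.rnDeriv σ x).toReal - (β.rnDeriv σ x).toReal)
    (((hloc α inferInstance).sub (hloc β inferInstance)).locallyIntegrableOn B) ?_
  · have hd : ∀ᵐ x ∂σ, x ∈ B → α.rnDeriv σ x = β.rnDeriv σ x := by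
      filter_upwards [hae, α.rnDeriv_lt_top σ, β.rnDeriv_lt_top σ] with x hx h1 h2 hxB
      exact (ENNReal.toReal_eq_toReal_iff' h1.ne h2.ne).1 (sub_eq_zero.1 (hx hxB))
    ext s hs
    rw [Measure.restrict_apply hs, Measure.restrict_apply hs,
      ← Measure.setLIntegral_rnDeriv hασ, ← Measure.setLIntegral_rnDeriv hβσ]
    refine setLIntegral_congr_fun_ae (hs.inter hB.measurableSet) ?_
    filter_upwards [hd] with x hx hxs using hx hxs.2
  · intro g hg hgs hgB
    have hgi : ∀ γ : Measure (Space d), IsLocallyFiniteMeasure γ → γ ≪ σ →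
        Integrable (fun x => (γ.rnDeriv σ x).toReal • g x) σ := fun γ _ hγ =>
      (integrable_rnDeriv_smul_iff hγ).2 (hg.continuous.integrable_of_hasCompactSupport hgs)
    have : ∀ x, g x • ((α.rnDeriv σ x).toReal - (β.rnDeriv σ x).toReal) =
        (α.rnDeriv σ x).toReal • g x - (β.rnDeriv σ x).toReal • g x := by
      intro x; simp only [smul_eq_mul]; ring
    simp only [this]
    rw [integral_sub (hgi α inferInstance hασ) (hgi β inferInstance hβσ),
      integral_rnDeriv_smul hασ, integral_rnDeriv_smul hβσ, h g hg hgs hgB, sub_self]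

/-- If two Coulomb potentials differ by a constant on an open set, the measures agree there. -/
lemma restrict_eq_of_potential_sub_const {d : ℕ} (hd : 3 ≤ d) {α β : Measure (Space d)}
    [IsLocallyFiniteMeasure α] [IsLocallyFiniteMeasure β]
    (hα : ∀ᵐ x, potential α x < ⊤) (hβ : ∀ᵐ x, potential β x < ⊤)
    {B : Set (Space d)} (hB : IsOpen B) {κ : ℝ}
    (h : ∀ᵐ x, x ∈ B → (potential α x).toReal - (potential β x).toReal = κ) :
    α.restrict B = β.restrict B := by
  refine restrict_eq_of_integral_contDiff_eq hB fun g hg hgs hgB => ?_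
  have hLc := (contDiff_laplacian hg).continuous
  have hLs := hasCompactSupport_laplacian hgs
  have h1 := integral_potential_mul_laplacian hd α hα hg hgs
  have h2 := integral_potential_mul_laplacian hd β hβ hg hgs
  have h3 : ∫ x, ((potential α x).toReal * laplacian g x -
      (potential β x).toReal * laplacian g x) = ∫ x, κ * laplacian g x := by
    refine integral_congr_ae ?_
    filter_upwards [h] with x hx
    by_cases hxB : x ∈ B
    · rw [← sub_mul, hx hxB]
    · have : laplacian g x = 0 := image_eq_zero_of_notMem_tsupport fun hx' =>
        hxB (hgB (tsupport_laplacian_subset g hx'))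
      simp [this]
  rw [integral_sub (integrable_potential_mul hd α hα hLc hLs)
    (integrable_potential_mul hd β hβ hLc hLs), integral_const_mul,
    integral_laplacian_eq_zero hg hgs, mul_zero, h1, h2, ← mul_sub] at h3
  have hd3 : (3 : ℝ) ≤ d := by exact_mod_cast hd
  have hc : -(d * (d - 2) * peakMass d) ≠ 0 :=
    neg_ne_zero.2 (mul_pos (mul_pos (by linarith) (by linarith)) (peakMass_pos d)).ne'
  exact sub_eq_zero.1 ((mul_eq_zero.1 h3).resolve_left hc)

/-- On a set carrying `α` and null for `β`, the identity reads `α + δ = γ`. No subtraction is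
needed, so infinite masses are harmless. -/
lemma le_of_add_eq_add_of_mutuallySingular {X : Type*} [MeasurableSpace X]
    {α β γ δ : Measure X} (hsing : α ⟂ₘ β) (h : α + δ = β + γ) : α ≤ γ := by
  obtain ⟨s, hs, hαs, hβs⟩ := hsing
  refine Measure.le_iff.2 fun A hA => ?_
  calc α A ≤ α (A ∩ s) + α (A \ s) := measure_le_inter_add_sdiff _ _ _
    _ ≤ 0 + (α + δ) (A \ s) := by
        gcongr
        · exact (measure_mono_null Set.inter_subset_right hαs).le
        · exact Measure.le_add_right le_rfl
    _ = β (A \ s) + γ (A \ s) := by rw [zero_add, h, Measure.add_apply]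
    _ ≤ 0 + γ A := by
        gcongr
        · exact (measure_mono_null (fun x hx => hx.2) hβs).le
        · exact Set.sdiff_subset
    _ = γ A := zero_add _

/-- The positive and negative parts of a signed measure are determined by their difference. -/
lemma SignedRadonMeasure.ext_of_add_eq_add {d : ℕ} {μ ν : SignedRadonMeasure d}
    (h : μ.pos + ν.neg = ν.pos + μ.neg) : μ = ν := by
  have h1 : μ.pos + ν.neg = μ.neg + ν.pos := h.trans (add_comm _ _)
  have h2 : ν.pos + μ.neg = ν.neg + μ.pos := h.symm.trans (add_comm _ _)
  have h3 : μ.neg + ν.pos = μ.pos + ν.neg := h1.symm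
  have h4 : ν.neg + μ.pos = ν.pos + μ.neg := h2.symm
  exact SignedRadonMeasure.ext
    (le_antisymm (le_of_add_eq_add_of_mutuallySingular μ.mutuallySingular h1)
      (le_of_add_eq_add_of_mutuallySingular ν.mutuallySingular h2))
    (le_antisymm (le_of_add_eq_add_of_mutuallySingular μ.mutuallySingular.symm h3)
      (le_of_add_eq_add_of_mutuallySingular ν.mutuallySingular.symm h4))

lemma potential_add {d : ℕ} (α β : Measure (Space d)) (x : Space d) :
    potential (α + β) x = potential α x + potential β x :=
  lintegral_add_measure _ _ _

lemma isLocallyFiniteMeasure_add {X : Type*} [TopologicalSpace X] [MeasurableSpace X]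
    (α β : Measure X) [IsLocallyFiniteMeasure α] [IsLocallyFiniteMeasure β] :
    IsLocallyFiniteMeasure (α + β) := by
  refine ⟨fun x => ?_⟩
  obtain ⟨s, hs, hαs⟩ := α.finiteAt_nhds x
  obtain ⟨t, ht, hβt⟩ := β.finiteAt_nhds x
  refine ⟨s ∩ t, inter_mem hs ht, ?_⟩
  rw [Measure.add_apply]
  exact ENNReal.add_lt_top.2 ⟨(measure_mono Set.inter_subset_left).trans_lt hαs,
    (measure_mono Set.inter_subset_right).trans_lt hβt⟩

/-- Signed measures agree on an open set if their potentials differ by a constant near each of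
its points. -/
lemma restrict_eq_of_locally_const {d : ℕ} (hd : 3 ≤ d) {μ ν : SignedRadonMeasure d}
    {v w : Space d → ℝ} (hv : IsCoulombPotential μ v) (hw : IsCoulombPotential ν w)
    {U : Set (Space d)}
    (h : ∀ x ∈ U, ∃ r > 0, ∃ κ, ∀ y ∈ Metric.ball x r, v y - w y = κ) :
    μ.restrict U = ν.restrict U := by
  have := μ.locallyFinite_pos
  have := μ.locallyFinite_neg
  have := ν.locallyFinite_pos
  have := ν.locallyFinite_neg
  -- Cross sums replace the difference `μ - ν` by a comparison of two positive measures, whose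
  -- potentials differ by `v - w` almost everywhere.
  have := isLocallyFiniteMeasure_add μ.pos ν.neg
  have := isLocallyFiniteMeasure_add ν.pos μ.neg
  have hα : ∀ᵐ x, potential (μ.pos + ν.neg) x < ⊤ := by
    filter_upwards [hv, hw] with x h1 h2
    rw [potential_add]
    exact ENNReal.add_lt_top.2 ⟨h1.1, h2.2.1⟩
  have hβ : ∀ᵐ x, potential (ν.pos + μ.neg) x < ⊤ := by
    filter_upwards [hv, hw] with x h1 h2
    rw [potential_add]
    exact ENNReal.add_lt_top.2 ⟨h2.1, h1.2.1⟩
  choose! r hr κ hκ using h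
  have hball : ∀ x ∈ U, (μ.pos + ν.neg).restrict (Metric.ball x (r x)) =
      (ν.pos + μ.neg).restrict (Metric.ball x (r x)) := by
    intro x hx
    refine restrict_eq_of_potential_sub_const hd hα hβ Metric.isOpen_ball (κ := κ x) ?_
    filter_upwards [hv, hw] with y h1 h2 hy
    rw [← hκ x hx y hy, h1.2.2, h2.2.2, potential_add, potential_add,
      ENNReal.toReal_add h1.1.ne h2.2.1.ne, ENNReal.toReal_add h2.1.ne h1.2.1.ne]
    ring
  obtain ⟨t, htU, htc, htcov⟩ := TopologicalSpace.countable_cover_nhdsWithin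
    (f := fun x => Metric.ball x (r x)) (s := U)
    fun x hx => mem_nhdsWithin_of_mem_nhds (Metric.ball_mem_nhds x (hr x hx))
  have hU : (μ.pos + ν.neg).restrict U = (ν.pos + μ.neg).restrict U :=
    Measure.restrict_congr_mono htcov
      ((Measure.restrict_biUnion_congr htc).2 fun x hx => hball x (htU hx))
  refine SignedRadonMeasure.ext_of_add_eq_add ?_
  rw [Measure.restrict_add, Measure.restrict_add] at hU
  exact hU

end Coulomb

end

theorem mainTheorem2 (d N : ℕ) (hd : 3 ≤ d) (hN : 2 ≤ N)
    (ρ : Coulomb.Space d → ℝ) (hρ_int : MeasureTheory.Integrable ρ MeasureTheory.volume)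
    (hρ_nonneg : ∀ᵐ x ∂(MeasureTheory.volume : MeasureTheory.Measure (Coulomb.Space d)), 0 ≤ ρ x)
    (hρ_mass : ∫ x, ρ x = N)
    (hΩ : IsConnected (Coulomb.densitySupport ρ))
    (ρext μext : Coulomb.SignedRadonMeasure d) (v w : Coulomb.Space d → ℝ)
    (hv : Coulomb.IsDualCharge N ρ ρext v) (hv_lip : ∃ K, LipschitzWith K v)
    (hw : Coulomb.IsDualCharge N ρ μext w) (hw_lip : ∃ K, LipschitzWith K w) :
    ρext.restrict (interior (Coulomb.densitySupport ρ)) =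
      μext.restrict (interior (Coulomb.densitySupport ρ)) := by
  obtain ⟨K, hK⟩ := hv_lip
  obtain ⟨L, hL⟩ := hw_lip
  refine Coulomb.restrict_eq_of_locally_const hd hv.1 hw.1 fun x hx => ?_
  obtain ⟨r, hr, hball⟩ := Metric.mem_nhds_iff.1 (mem_interior_iff_mem_nhds.1 hx)
  exact ⟨r, hr, v x - w x, fun y hy => Coulomb.sub_eq_sub_of_convex_subset hd hN hρ_int hρ_nonneg
    hv.2 hw.2 hK hL (convex_ball x r) hball hy (Metric.mem_ball_self hr)⟩
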